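/- **Conventions.** A scwol (small category without loops) $\mathcal Y$ consists of a set $V(\mathcal Y)$ of objects and a set $E(\mathcal Y)$ of non-identity morphisms (edges) $a$ with source $i(a)$ and target $t(a)$, $i(a)\neq t(a)$, and an associative composition $(a,b)\mapsto ab\in E(\mathcal Y)$ for $i(a)=t(b)$, with $i(ab)=i(b)$, $t(ab)=t(a)$. A morphism of scwols is a functor mapping edges to edges. In an edge path, $a\in E(\mathcal Y)$ is traversed as $a^+$ from $t(a)$ to $i(a)$ or as $a^-$ from $i(a)$ to $t(a)$; homotopy of edge paths is generated by cancelling $a^{\pm}a^{\mp}$ and by $a^+b^+\leftrightarrow(ab)^+$, $b^-a^-\leftrightarrow (ab)^-$. $\mathcal Y$ is connected if $V(\mathcal Y)\ne\emptyset$ and any two objects are joined by an edge path, and simply connected if moreover every closed edge path is null-homotopic. A complex of groups $G(\mathcal Y)=(G_\sigma,\psi_a,g_{a,b})$ over $\mathcal Y$ consists of groups $G_\sigma$ ($\sigma\in V(\mathcal Y)$), injective homomorphisms $\psi_a:G_{i(a)}\to G_{t(a)}$ ($a\in E(\mathcal Y)$) and elements $g_{a,b}\in G_{t(a)}$ for composable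 $(a,b)$, with $\mathrm{Ad}(g_{a,b})\psi_{ab}=\psi_a\psi_b$ (where $\mathrm{Ad}(g)h=ghg^{-1}$) and $\psi_a(g_{b,c})g_{a,bc}=g_{a,b}g_{ab,c}$. A morphism $\phi:H(\mathcal Y)\to G(\mathcal X)$ over a morphism $f:\mathcal Y\to\mathcal X$ of scwols consists of homomorphisms $\phi_\sigma:H_\sigma\to G_{f(\sigma)}$ and elements $\phi(a)\in G_{t(f(a))}$ with $\mathrm{Ad}(\phi(a))\psi_{f(a)}\phi_{i(a)}=\phi_{t(a)}\psi_a$ and $\phi_{t(a)}(h_{a,b})\phi(ab)=\phi(a)\,\psi_{f(a)}(\phi(b))\,g_{f(a),f(b)}$ (where $h_{a,b}$ are the twisting elements of $H(\mathcal Y)$); it is an isomorphism if $f$ and all $\phi_\sigma$ are. The group $FG(\mathcal Y)$ is generated by $\bigsqcup_\sigma G_\sigma\sqcup\{a^{\pm}:a\in E(\mathcal Y)\}$ subject to the relations of the $G_\sigma$, $(a^{+})^{-1}=a^{-}$, $a^+b^+=g_{a,b}(ab)^+$ and $a^+ga^-=\psi_a(g)$ for $g\in G_{i(a)}$. The fundamental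 group $\pi_1(G(\mathcal Y),\sigma)$ is the subgroup of the elements $g_0e_1g_1\cdots e_kg_k$, where $(e_1,\dots,e_k)$ is a closed edge path at $\sigma$, $g_0\in G_\sigma$, and $g_j$ lies in the local group at the end point of $e_j$. A morphism $\phi$ over $f$ induces $\phi_*:\pi_1(H(\mathcal Y),\sigma)\to\pi_1(G(\mathcal X),f(\sigma))$ by $h\mapsto\phi_\mu(h)$ for $h\in H_\mu$, and $a^+\mapsto\phi(a)f(a)^+$; $\phi$ is $\pi_1$-injective if $\phi_*$ is injective for every base object $\sigma$. An action of a group $\Gamma$ on a scwol $\mathcal X$ is a homomorphism $\Gamma\to\mathrm{Aut}(\mathcal X)$ such that $g.i(a)\ne t(a)$ for all $g,a$, and $g.i(a)=i(a)$ implies $g.a=a$. Its associated complex of groups over $\mathcal Y=\Gamma\backslash\mathcal X$ is obtained by choosing for each $\sigma\in V(\mathcal Y)$ a lift $\bar\sigma$, for each $a\in E(\mathcal Y)$ the lift $\bar a$ with $i(\bar a)=\overline{i(a)}$ and an $h_a\in\Gamma$ with $h_a.t(\bar a)=\overline{t(a)}$, and putting $G_\sigma=\mathrm{Stab}(\bar\sigma)$,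 $\psi_a=\mathrm{Ad}(h_a)$, $g_{a,b}=h_ah_bh_{ab}^{-1}$. A complex of groups is developable if it is isomorphic to one associated to an action of a group on a simply connected scwol. **Local complexes of groups.** Let $\gamma\in V(\mathcal Y)$. Below, $c$ denotes edges of $\mathcal Y$ with $t(c)=\gamma$ and $b$ denotes edges with $i(b)=\gamma$. The scwol $\mathcal Y(\gamma)$ has as objects all such $c$, the object $\gamma$, and all such $b$. Its edges are * $(c,d)$, with $d\in E(\mathcal Y)$ and $t(d)=i(c)$, from $cd$ to $c$; * $\gamma*c$ from $c$ to $\gamma$; * $b*c$ from $c$ to $b$; * $b*\gamma$ from $\gamma$ to $b$; * $(a,b)$, with $a\in E(\mathcal Y)$ and $i(a)=t(b)$, from $b$ to $ab$. Composition is $(c,d)(cd,d')=(c,dd')$, $(a',ab)(a,b)=(a'a,b)$, $(\gamma*c)(c,d)=\gamma*cd$, $(b*c)(c,d)=b*cd$, $(a,b)(b*c)=ab*c$, $(b*\gamma)(\gamma*c)=b*c$, $(a,b)(b*\gamma)=ab*\gamma$. The morphism $h:\mathcal Y(\gamma)\to\mathcal Y$ is given on objects by $c\mapsto i(c)$, $\gamma\mapsto\gamma$,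 $b\mapsto t(b)$ and on edges by $(c,d)\mapsto d$, $\gamma*c\mapsto c$, $b*c\mapsto bc$, $b*\gamma\mapsto b$, $(a,b)\mapsto a$. The local complex of groups $L(\mathcal Y(\gamma))$ has local groups $L_c=G_{i(c)}$, $L_\gamma=L_b=G_\gamma$; homomorphisms $\psi_d$ for $(c,d)$, $\psi_c$ for $\gamma*c$ and $b*c$, and $\mathrm{id}_{G_\gamma}$ for $b*\gamma$ and $(a,b)$; and twisting elements $g_{d,d'}$ for $((c,d),(cd,d'))$, $g_{c,d}$ for $(\gamma*c,(c,d))$ and $(b*c,(c,d))$, and $e$ for all other composable pairs. The canonical morphism $\Sigma:L(\mathcal Y(\gamma))\to G(\mathcal Y)$ over $h$ is given by $\Sigma_c=\mathrm{id}$, $\Sigma_\gamma=\mathrm{id}$, $\Sigma_b=\psi_b$ and $\Sigma(b*c)=g_{b,c}$, $\Sigma((a,b))=g_{a,b}^{-1}$, $\Sigma((c,d))=\Sigma(\gamma*c)=\Sigma(b*\gamma)=e$. **Corollary 1.2.** Let $\mathcal Y$ be a connected scwol and $G(\mathcal Y)$ a complex of groups over $\mathcal Y$. Then $G(\mathcal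 Y)$ is developable if and only if for every $\gamma\in V(\mathcal Y)$ the canonical morphism $\Sigma:L(\mathcal Y(\gamma))\to G(\mathcal Y)$ is $\pi_1$-injective. -/

import Mathlib

universe u v w u' v' w'

/-- A small category without loops, given by its objects `V` and its non-identity morphisms
("edges"): `Edge σ τ` is the set of non-identity morphisms `a` with `i(a) = σ` and `t(a) = τ`.
The composite `ab` (first `b`, then `a`) of non-identity morphisms is again one, composition is
associative, and no non-identity morphism is a loop. -/
structure Scwol where
  V : Type u
  Edge : V → V → Type v
  comp : ∀ {σ τ ρ : V}, Edge τ ρ → Edge σ τ → Edge σ ρ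
  assoc : ∀ {σ τ ρ μ : V} (a : Edge ρ μ) (b : Edge τ ρ) (c : Edge σ τ),
    comp (comp a b) c = comp a (comp b c)
  loopless : ∀ σ : V, IsEmpty (Edge σ σ)

namespace Scwol

/-- The set `E(Y)` of all edges of a scwol. -/
structure E (Y : Scwol.{u, v}) where
  src : Y.V
  tgt : Y.V
  edge : Y.Edge src tgt

/-- A morphism of scwols: a functor that sends non-identity morphisms to non-identity morphisms. -/
@[ext]
structure Hom (Y : Scwol.{u, v}) (X : Scwol.{u', v'}) where
  obj : Y.V → X.V
  map : ∀ {σ τ : Y.V}, Y.Edge σ τ → X.Edge (obj σ) (obj τ)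
  map_comp : ∀ {σ τ ρ : Y.V} (a : Y.Edge τ ρ) (b : Y.Edge σ τ),
    map (Y.comp a b) = X.comp (map a) (map b)

/-- The map on sets of edges given by a morphism of scwols. -/
def Hom.onE {Y : Scwol.{u, v}} {X : Scwol.{u', v'}} (f : Y.Hom X) (e : Y.E) : X.E :=
  ⟨f.obj e.src, f.obj e.tgt, f.map e.edge⟩

/-- The identity morphism of a scwol. -/
def Hom.id (Y : Scwol.{u, v}) : Y.Hom Y := ⟨fun σ => σ, fun a => a, fun _ _ => rfl⟩

/-- The monoid of endomorphisms of a scwol; its invertible elements are the automorphisms. -/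
instance (Y : Scwol.{u, v}) : Monoid (Y.Hom Y) where
  mul f g := ⟨fun σ => f.obj (g.obj σ), fun a => f.map (g.map a),
    fun a b => by rw [g.map_comp, f.map_comp]⟩
  one := Hom.id Y
  mul_assoc _ _ _ := rfl
  one_mul _ := rfl
  mul_one _ := rfl

/-- Edge paths in a scwol. An edge `a` may be traversed as `a⁺`, from `t(a)` to `i(a)`, or
as `a⁻`, from `i(a)` to `t(a)`. -/
inductive Path (Y : Scwol.{u, v}) : Y.V → Y.V → Type (max u v)
  | nil (σ : Y.V) : Path Y σ σ
  | pos {σ τ ρ : Y.V} (a : Y.Edge σ τ) (p : Path Y σ ρ) : Path Y τ ρ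
  | neg {σ τ ρ : Y.V} (a : Y.Edge σ τ) (p : Path Y τ ρ) : Path Y σ ρ

/-- Homotopy of edge paths with fixed end points: the equivalence relation generated by inserting
or deleting `a⁺a⁻` and `a⁻a⁺`, and by exchanging `a⁺b⁺` for `(ab)⁺` and `b⁻a⁻` for `(ab)⁻`. -/
inductive Homotopic (Y : Scwol.{u, v}) : ∀ {σ τ : Y.V}, Y.Path σ τ → Y.Path σ τ → Prop
  | refl {σ τ : Y.V} (p : Y.Path σ τ) : Homotopic Y p p
  | symm {σ τ : Y.V} {p q : Y.Path σ τ} : Homotopic Y p q → Homotopic Y q p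
  | trans {σ τ : Y.V} {p q r : Y.Path σ τ} :
      Homotopic Y p q → Homotopic Y q r → Homotopic Y p r
  | pos_congr {σ τ ρ : Y.V} (a : Y.Edge σ τ) {p q : Y.Path σ ρ} :
      Homotopic Y p q → Homotopic Y (.pos a p) (.pos a q)
  | neg_congr {σ τ ρ : Y.V} (a : Y.Edge σ τ) {p q : Y.Path τ ρ} :
      Homotopic Y p q → Homotopic Y (.neg a p) (.neg a q)
  | pos_neg {σ τ ρ : Y.V} (a : Y.Edge σ τ) (p : Y.Path τ ρ) :
      Homotopic Y (.pos a (.neg a p)) p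
  | neg_pos {σ τ ρ : Y.V} (a : Y.Edge σ τ) (p : Y.Path σ ρ) :
      Homotopic Y (.neg a (.pos a p)) p
  | pos_pos {σ τ ρ μ : Y.V} (a : Y.Edge τ ρ) (b : Y.Edge σ τ) (p : Y.Path σ μ) :
      Homotopic Y (.pos a (.pos b p)) (.pos (Y.comp a b) p)
  | neg_neg {σ τ ρ μ : Y.V} (a : Y.Edge τ ρ) (b : Y.Edge σ τ) (p : Y.Path ρ μ) :
      Homotopic Y (.neg b (.neg a p)) (.neg (Y.comp a b) p)

/-- A scwol is connected if it is non-empty and any two objects are joined by an edge path. -/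
def IsConnected (Y : Scwol.{u, v}) : Prop :=
  Nonempty Y.V ∧ ∀ σ τ : Y.V, Nonempty (Y.Path σ τ)

/-- A scwol is simply connected if it is connected and every closed edge path is null-homotopic,
that is, all its (edge path) fundamental groups are trivial. -/
def IsSimplyConnected (Y : Scwol.{u, v}) : Prop :=
  Y.IsConnected ∧ ∀ (σ : Y.V) (p : Y.Path σ σ), Y.Homotopic p (.nil σ)

end Scwol

/-- A complex of groups `G(Y) = (G_σ, ψ_a, g_{a,b})` over a scwol `Y`. -/
structure ComplexOfGroups (Y : Scwol.{u, v}) where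
  grp : Y.V → Type w
  [inst : ∀ σ, Group (grp σ)]
  ψ : ∀ {σ τ : Y.V}, Y.Edge σ τ → grp σ →* grp τ
  ψ_injective : ∀ {σ τ : Y.V} (a : Y.Edge σ τ), Function.Injective (ψ a)
  tw : ∀ {σ τ ρ : Y.V}, Y.Edge τ ρ → Y.Edge σ τ → grp ρ
  ad_tw : ∀ {σ τ ρ : Y.V} (a : Y.Edge τ ρ) (b : Y.Edge σ τ) (x : grp σ),
    tw a b * ψ (Y.comp a b) x * (tw a b)⁻¹ = ψ a (ψ b x)
  cocycle : ∀ {σ τ ρ μ : Y.V} (a : Y.Edge ρ μ) (b : Y.Edge τ ρ) (c : Y.Edge σ τ),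
    ψ a (tw b c) * tw a (Y.comp b c) = tw a b * tw (Y.comp a b) c

attribute [instance] ComplexOfGroups.inst

namespace ComplexOfGroups

/-- A morphism `φ : H(Y) → G(X)` of complexes of groups over a morphism `f : Y → X` of scwols. -/
structure Hom {Y : Scwol.{u, v}} {X : Scwol.{u', v'}} (f : Y.Hom X)
    (H : ComplexOfGroups.{u, v, w} Y) (G : ComplexOfGroups.{u', v', w'} X) where
  loc : ∀ σ : Y.V, H.grp σ →* G.grp (f.obj σ)
  elt : ∀ {σ τ : Y.V}, Y.Edge σ τ → G.grp (f.obj τ)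
  ad_elt : ∀ {σ τ : Y.V} (a : Y.Edge σ τ) (x : H.grp σ),
    elt a * G.ψ (f.map a) (loc σ x) * (elt a)⁻¹ = loc τ (H.ψ a x)
  elt_comp : ∀ {σ τ ρ : Y.V} (a : Y.Edge τ ρ) (b : Y.Edge σ τ),
    loc ρ (H.tw a b) * elt (Y.comp a b)
      = elt a * G.ψ (f.map a) (elt b) * G.tw (f.map a) (f.map b)

section FundamentalGroup

variable {Y : Scwol.{u, v}} (G : ComplexOfGroups.{u, v, w} Y)

/-- Generators of the universal group: the elements of the local groups, and `a⁺` for every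
edge `a` (with `a⁻` being the inverse of `a⁺`). -/
inductive Gen : Type (max u v w)
  | ofGrp {σ : Y.V} (g : G.grp σ) : Gen
  | ofEdge {σ τ : Y.V} (a : Y.Edge σ τ) : Gen

/-- Relators of the universal group: the relations of the local groups,
`a⁺b⁺ = g_{a,b}(ab)⁺` and `a⁺ g a⁻ = ψ_a(g)`. -/
inductive Relator : FreeGroup (Gen G) → Prop
  | mul {σ : Y.V} (g h : G.grp σ) :
      Relator (FreeGroup.of (.ofGrp g) * FreeGroup.of (.ofGrp h) *
        (FreeGroup.of (.ofGrp (g * h)))⁻¹)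
  | comp {σ τ ρ : Y.V} (a : Y.Edge τ ρ) (b : Y.Edge σ τ) :
      Relator (FreeGroup.of (.ofEdge a) * FreeGroup.of (.ofEdge b) *
        (FreeGroup.of (.ofGrp (G.tw a b)) * FreeGroup.of (.ofEdge (Y.comp a b)))⁻¹)
  | conj {σ τ : Y.V} (a : Y.Edge σ τ) (g : G.grp σ) :
      Relator (FreeGroup.of (.ofEdge a) * FreeGroup.of (.ofGrp g) *
        (FreeGroup.of (.ofEdge a))⁻¹ * (FreeGroup.of (.ofGrp (G.ψ a g)))⁻¹)

/-- The universal group `FG(Y)`. -/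
abbrev UniversalGroup : Type (max u v w) := PresentedGroup {r | Relator G r}

/-- The natural homomorphism `G_σ → FG(Y)`. -/
def ofGrp (σ : Y.V) : G.grp σ →* UniversalGroup G :=
  MonoidHom.mk' (fun g => PresentedGroup.of (.ofGrp g)) fun g h =>
    (mul_inv_eq_one.mp (PresentedGroup.one_of_mem
      (rels := {r | Relator G r}) (Relator.mul g h))).symm

/-- The element `a⁺` of `FG(Y)`. -/
def ofEdge {σ τ : Y.V} (a : Y.Edge σ τ) : UniversalGroup G := PresentedGroup.of (.ofEdge a)

/-- `IsPathElt σ τ x` says that `x ∈ FG(Y)` is represented by a `G(Y)`-path from `σ` to `τ`: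
`x = g₀ e₁ g₁ ⋯ e_k g_k`, where `(e₁, …, e_k)` is an edge path in `Y` from `σ` to `τ`, each `e_i` is
some `a⁺` (from `t(a)` to `i(a)`) or `a⁻` (from `i(a)` to `t(a)`), and each `g_i` lies in the local
group at the object reached after `e_i` (at `σ` for `i = 0`). -/
inductive IsPathElt : Y.V → Y.V → UniversalGroup G → Prop
  | nil {σ : Y.V} (g : G.grp σ) : IsPathElt σ σ (G.ofGrp σ g)
  | pos {σ τ ρ : Y.V} (g : G.grp τ) (a : Y.Edge σ τ) {x : UniversalGroup G}
      (hx : IsPathElt σ ρ x) : IsPathElt τ ρ (G.ofGrp τ g * G.ofEdge a * x)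
  | neg {σ τ ρ : Y.V} (g : G.grp σ) (a : Y.Edge σ τ) {x : UniversalGroup G}
      (hx : IsPathElt τ ρ x) : IsPathElt σ ρ (G.ofGrp σ g * (G.ofEdge a)⁻¹ * x)

variable {G}

theorem IsPathElt.smul {σ τ : Y.V} {x : UniversalGroup G} (g : G.grp σ)
    (hx : G.IsPathElt σ τ x) : G.IsPathElt σ τ (G.ofGrp σ g * x) := by
  cases hx with
  | nil h => rw [← map_mul]; exact .nil _
  | pos h a hx =>
    rw [← mul_assoc, ← mul_assoc, ← map_mul]; exact .pos _ a hx
  | neg h a hx =>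
    rw [← mul_assoc, ← mul_assoc, ← map_mul]; exact .neg _ a hx

theorem IsPathElt.mul {σ τ ρ : Y.V} {x y : UniversalGroup G}
    (hx : G.IsPathElt σ τ x) (hy : G.IsPathElt τ ρ y) : G.IsPathElt σ ρ (x * y) := by
  induction hx with
  | nil g => exact hy.smul g
  | pos g a _ ih => rw [mul_assoc]; exact .pos g a (ih hy)
  | neg g a _ ih => rw [mul_assoc]; exact .neg g a (ih hy)

theorem IsPathElt.inv {σ τ : Y.V} {x : UniversalGroup G}
    (hx : G.IsPathElt σ τ x) : G.IsPathElt τ σ x⁻¹ := by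
  induction hx with
  | nil g => rw [← map_inv]; exact .nil _
  | @pos σ τ ρ g a x _ ih =>
    have h : G.IsPathElt σ τ (G.ofGrp σ 1 * (G.ofEdge a)⁻¹ * G.ofGrp τ g⁻¹) :=
      .neg 1 a (.nil _)
    have := ih.mul h
    rw [map_one, one_mul, map_inv] at this
    rwa [mul_inv_rev, mul_inv_rev]
  | @neg σ τ ρ g a x _ ih =>
    have h : G.IsPathElt τ σ (G.ofGrp τ 1 * G.ofEdge a * G.ofGrp σ g⁻¹) :=
      .pos 1 a (.nil _)
    have := ih.mul h
    rw [map_one, one_mul, map_inv] at this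
    rwa [mul_inv_rev, mul_inv_rev, inv_inv]

variable (G)

/-- The fundamental group `π₁(G(Y), σ)`: homotopy classes of `G(Y)`-loops at `σ`, that is, the
subgroup of `FG(Y)` of the elements represented by `G(Y)`-paths from `σ` to `σ`. -/
def piOne (σ : Y.V) : Subgroup (UniversalGroup G) where
  carrier := {x | G.IsPathElt σ σ x}
  one_mem' := by
    have : G.IsPathElt σ σ (G.ofGrp σ 1) := .nil 1
    rwa [map_one] at this
  mul_mem' := IsPathElt.mul
  inv_mem' := IsPathElt.inv

theorem ofEdge_mul {σ τ ρ : Y.V} (a : Y.Edge τ ρ) (b : Y.Edge σ τ) :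
    G.ofEdge a * G.ofEdge b = G.ofGrp ρ (G.tw a b) * G.ofEdge (Y.comp a b) :=
  mul_inv_eq_one.mp (PresentedGroup.one_of_mem
      (rels := {r | Relator G r}) (Relator.comp a b))

theorem ofEdge_conj {σ τ : Y.V} (a : Y.Edge σ τ) (g : G.grp σ) :
    G.ofEdge a * G.ofGrp σ g * (G.ofEdge a)⁻¹ = G.ofGrp τ (G.ψ a g) :=
  mul_inv_eq_one.mp (PresentedGroup.one_of_mem
      (rels := {r | Relator G r}) (Relator.conj a g))

end FundamentalGroup

namespace Hom

variable {Y : Scwol.{u, v}} {X : Scwol.{u', v'}} {f : Y.Hom X}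
  {H : ComplexOfGroups.{u, v, w} Y} {G : ComplexOfGroups.{u', v', w'} X} (φ : Hom f H G)

/-- Images of the generators: `h ↦ φ_σ(h)` and `a⁺ ↦ φ(a) f(a)⁺`. -/
def genMap : Gen H → UniversalGroup G
  | .ofGrp (σ := σ) g => G.ofGrp (f.obj σ) (φ.loc σ g)
  | .ofEdge (τ := τ) a => G.ofGrp (f.obj τ) (φ.elt a) * G.ofEdge (f.map a)

/-- The homomorphism `FH(Y) → FG(X)` with `h ↦ φ_σ(h)` and `a⁺ ↦ φ(a) f(a)⁺`. -/
def onUniversal : UniversalGroup H →* UniversalGroup G :=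
  PresentedGroup.toGroup (f := φ.genMap) <| by
    rintro _ (⟨g, h⟩ | ⟨a, b⟩ | ⟨a, g⟩)
    · simp [genMap]
    · simp only [map_mul, map_inv, FreeGroup.lift_apply_of, genMap]
      rw [mul_inv_eq_one, f.map_comp, ← mul_assoc (G.ofGrp _ (φ.loc _ _)), ← map_mul,
        φ.elt_comp, map_mul, map_mul, mul_assoc _ (G.ofGrp _ (G.tw _ _)), ← ofEdge_mul,
        ← ofEdge_conj]
      group
    · simp only [map_mul, map_inv, FreeGroup.lift_apply_of, genMap]
      rw [mul_inv_eq_one, ← φ.ad_elt, map_mul, map_mul, map_inv, ← ofEdge_conj]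
      group

@[simp] theorem onUniversal_ofGrp (σ : Y.V) (g : H.grp σ) :
    φ.onUniversal (H.ofGrp σ g) = G.ofGrp (f.obj σ) (φ.loc σ g) :=
  PresentedGroup.toGroup.of _

@[simp] theorem onUniversal_ofEdge {σ τ : Y.V} (a : Y.Edge σ τ) :
    φ.onUniversal (H.ofEdge a) = G.ofGrp (f.obj τ) (φ.elt a) * G.ofEdge (f.map a) :=
  PresentedGroup.toGroup.of _

theorem isPathElt_map {σ τ : Y.V} {x : UniversalGroup H} (hx : H.IsPathElt σ τ x) :
    G.IsPathElt (f.obj σ) (f.obj τ) (φ.onUniversal x) := by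
  induction hx with
  | nil g => rw [onUniversal_ofGrp]; exact .nil _
  | pos g a _ ih =>
    rw [map_mul, map_mul, onUniversal_ofGrp, onUniversal_ofEdge, ← mul_assoc, ← map_mul]
    exact .pos _ _ ih
  | neg g a _ ih =>
    rw [map_mul, map_mul, map_inv, onUniversal_ofGrp, onUniversal_ofEdge, mul_inv_rev,
      ← mul_assoc, ← map_inv, mul_assoc]
    exact .neg _ _ (ih.smul _)

/-- The induced homomorphism `φ_* : π₁(H(Y), σ) → π₁(G(X), f(σ))`. -/
def onPiOne (σ : Y.V) : H.piOne σ →* G.piOne (f.obj σ) :=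
  (φ.onUniversal.comp (H.piOne σ).subtype).codRestrict (G.piOne (f.obj σ))
    fun x => φ.isPathElt_map x.2

/-- A morphism is `π₁`-injective if it is injective on fundamental groups, for all base points. -/
def IsPiOneInjective : Prop := ∀ σ : Y.V, Function.Injective (φ.onPiOne σ)

end Hom

end ComplexOfGroups

namespace Scwol

/-- An action of a group `Γ` on a scwol `X`: a homomorphism from `Γ` to the automorphisms of `X`
(a monoid homomorphism out of a group takes invertible values), such that there are no inversions,
and every element fixing `i(a)` fixes the edge `a`. -/
structure Action (Γ : Type w) [Group Γ] (X : Scwol.{u, v}) where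
  act : Γ →* X.Hom X
  no_inversion : ∀ (g : Γ) (e : X.E), (act g).obj e.src ≠ e.tgt
  fix_edge : ∀ (g : Γ) (e : X.E), (act g).obj e.src = e.src → (act g).onE e = e

namespace Action

variable {Γ : Type w} [Group Γ] {X : Scwol.{u, v}} (A : Action Γ X)

theorem act_mul_obj (g h : Γ) (x : X.V) :
    (A.act (g * h)).obj x = (A.act g).obj ((A.act h).obj x) := by rw [map_mul]; rfl

theorem act_one_obj (x : X.V) : (A.act 1).obj x = x := by rw [map_one]; rfl

theorem act_inv_obj {g : Γ} {x y : X.V} (h : (A.act g).obj x = y) : (A.act g⁻¹).obj y = x := by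
  rw [← h, ← act_mul_obj, inv_mul_cancel, act_one_obj]

/-- The isotropy subgroup of an object. -/
def stab (x : X.V) : Subgroup Γ where
  carrier := {g | (A.act g).obj x = x}
  one_mem' := A.act_one_obj x
  mul_mem' {g h} hg hh := by
    change (A.act g).obj x = x at hg
    change (A.act h).obj x = x at hh
    change (A.act (g * h)).obj x = x
    rw [act_mul_obj, hh, hg]
  inv_mem' h := A.act_inv_obj h

/-- A morphism `p : X → Y` exhibiting `Y` as the quotient scwol `Γ\X`: it is surjective on objects
and on edges, and its fibres on objects and on edges are exactly the `Γ`-orbits. -/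
structure QuotientMap (Y : Scwol.{u', v'}) where
  p : X.Hom Y
  obj_surjective : Function.Surjective p.obj
  onE_surjective : Function.Surjective p.onE
  obj_eq_iff : ∀ x y : X.V, p.obj x = p.obj y ↔ ∃ g : Γ, (A.act g).obj x = y
  onE_eq_iff : ∀ e e' : X.E, p.onE e = p.onE e' ↔ ∃ g : Γ, (A.act g).onE e = e'

namespace QuotientMap

variable {A} {Y : Scwol.{u', v'}} (Q : A.QuotientMap Y)

theorem edge_unique {e e' : X.E} (hs : e.src = e'.src) (hp : Q.p.onE e = Q.p.onE e') :
    e = e' := by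
  obtain ⟨g, rfl⟩ := (Q.onE_eq_iff e e').mp hp
  exact (A.fix_edge g e hs.symm).symm

/-- The choices made in passing from an action to a complex of groups over the quotient: for each
object `σ` of `Y` an object `σ̄` of `X` over it; for each edge `a` from `σ` to `τ` the (unique) edge
`ā` of `X` over `a` with `i(ā) = σ̄`; and an element `h_a` of `Γ` with `h_a · t(ā) = τ̄`. -/
structure Lifts where
  vert : Y.V → X.V
  p_vert : ∀ σ : Y.V, Q.p.obj (vert σ) = σ
  tgt : ∀ {σ τ : Y.V}, Y.Edge σ τ → X.V
  edge : ∀ {σ τ : Y.V} (a : Y.Edge σ τ), X.Edge (vert σ) (tgt a)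
  p_edge : ∀ {σ τ : Y.V} (a : Y.Edge σ τ), Q.p.onE ⟨vert σ, tgt a, edge a⟩ = ⟨σ, τ, a⟩
  h : ∀ {σ τ : Y.V}, Y.Edge σ τ → Γ
  h_tgt : ∀ {σ τ : Y.V} (a : Y.Edge σ τ), (A.act (h a)).obj (tgt a) = vert τ

namespace Lifts

variable {Q} (L : Q.Lifts)

theorem conj_mem {σ τ : Y.V} (a : Y.Edge σ τ) {g : Γ} (hg : g ∈ A.stab (L.vert σ)) :
    L.h a * g * (L.h a)⁻¹ ∈ A.stab (L.vert τ) := by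
  have h1 := congrArg Scwol.E.tgt (A.fix_edge g ⟨L.vert σ, L.tgt a, L.edge a⟩ hg)
  change (A.act g).obj (L.tgt a) = L.tgt a at h1
  change (A.act _).obj _ = _
  rw [act_mul_obj, act_mul_obj, A.act_inv_obj (L.h_tgt a), h1, L.h_tgt]

theorem tgt_comp {σ τ ρ : Y.V} (a : Y.Edge τ ρ) (b : Y.Edge σ τ) :
    L.tgt (Y.comp a b) = (A.act (L.h b)⁻¹).obj (L.tgt a) := by
  have hinv := A.act_inv_obj (L.h_tgt b)
  have h1 : Q.p.onE ((A.act (L.h b)⁻¹).onE ⟨_, _, L.edge a⟩) = ⟨τ, ρ, a⟩ := by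
    rw [← L.p_edge a]
    exact ((Q.onE_eq_iff _ _).mpr ⟨_, rfl⟩).symm
  have key : ∀ (x y : X.V) (e : X.Edge x y) (e₂ : X.Edge (L.vert σ) x),
      Q.p.onE ⟨_, _, e⟩ = ⟨τ, ρ, a⟩ → Q.p.onE ⟨_, _, e₂⟩ = ⟨σ, τ, b⟩ →
      L.tgt (Y.comp a b) = y := by
    intro x y e e₂ he he₂
    have h3 : Q.p.onE ⟨_, _, X.comp e e₂⟩ = ⟨σ, ρ, Y.comp a b⟩ := by
      simp only [Hom.onE, Hom.map_comp] at he he₂ ⊢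
      generalize Q.p.map e = m at he ⊢
      generalize Q.p.map e₂ = m₂ at he₂ ⊢
      generalize Q.p.obj x = x' at *
      generalize Q.p.obj y = y' at *
      generalize Q.p.obj (L.vert σ) = s' at *
      cases he
      cases he₂
      rfl
    have := Q.edge_unique (e := ⟨_, _, L.edge (Y.comp a b)⟩) (e' := ⟨_, _, X.comp e e₂⟩) rfl
      (by rw [h3, L.p_edge])
    exact congrArg Scwol.E.tgt this
  have : ∀ (x : X.V) (hx : x = L.tgt b) (e : X.Edge x ((A.act (L.h b)⁻¹).obj (L.tgt a))),
      Q.p.onE ⟨_, _, e⟩ = ⟨τ, ρ, a⟩ →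
      L.tgt (Y.comp a b) = (A.act (L.h b)⁻¹).obj (L.tgt a) := by
    rintro x rfl e he
    exact key _ _ e (L.edge b) he (L.p_edge b)
  exact this _ hinv ((A.act (L.h b)⁻¹).map (L.edge a)) h1

theorem tw_mem {σ τ ρ : Y.V} (a : Y.Edge τ ρ) (b : Y.Edge σ τ) :
    L.h a * L.h b * (L.h (Y.comp a b))⁻¹ ∈ A.stab (L.vert ρ) := by
  change (A.act _).obj _ = _
  rw [act_mul_obj, A.act_inv_obj (L.h_tgt _), tgt_comp, act_mul_obj, ← A.act_mul_obj (L.h b),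
    mul_inv_cancel, act_one_obj, L.h_tgt]

/-- The complex of groups associated to an action (and to the choices made): `G_σ` is the isotropy
subgroup of `σ̄`, `ψ_a(g) = h_a g h_a⁻¹`, and `g_{a,b} = h_a h_b h_{ab}⁻¹`. -/
def complex : ComplexOfGroups.{u', v', w} Y where
  grp σ := A.stab (L.vert σ)
  ψ a := MonoidHom.mk' (fun g => ⟨L.h a * g.1 * (L.h a)⁻¹, L.conj_mem a g.2⟩) fun g g' => by
    apply Subtype.ext
    simp only [Subgroup.coe_mul]
    group
  ψ_injective a g g' hgg := by
    have := congrArg Subtype.val hgg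
    simpa using this
  tw a b := ⟨L.h a * L.h b * (L.h (Y.comp a b))⁻¹, L.tw_mem a b⟩
  ad_tw a b x := by
    apply Subtype.ext
    simp only [MonoidHom.mk'_apply, Subgroup.coe_mul, Subgroup.coe_inv]
    group
  cocycle a b c := by
    apply Subtype.ext
    simp only [MonoidHom.mk'_apply, Subgroup.coe_mul, Y.assoc]
    group

end Lifts

end QuotientMap

end Action

end Scwol

/-- A complex of groups `G(Y)` is developable if it arises from a group `Γ` acting on a simply
connected scwol `X`: `Y` is the quotient `Γ\X`, and `G(Y)` is isomorphic (over the identity of `Y`)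
to the complex of groups associated to the action. -/
def ComplexOfGroups.IsDevelopable {Y : Scwol.{u, v}} (G : ComplexOfGroups.{u, v, w} Y) : Prop :=
  ∃ (X : Scwol.{max u v w, v}) (Γ : Type (max u v w)) (_ : Group Γ) (A : Scwol.Action Γ X)
    (Q : A.QuotientMap Y) (L : Q.Lifts),
    X.IsSimplyConnected ∧
      ∃ φ : ComplexOfGroups.Hom (Scwol.Hom.id Y) G L.complex,
        ∀ σ : Y.V, Function.Bijective (φ.loc σ)

namespace Scwol

/-- Objects of the local scwol `Y(γ)`: those of the upper link (edges `c` with `t(c) = γ`),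
the object `γ`, and those of the lower link (edges `b` with `i(b) = γ`). -/
inductive LocalVertex (Y : Scwol.{u, v}) (γ : Y.V) : Type (max u v)
  | upper {σ : Y.V} (c : Y.Edge σ γ) : LocalVertex Y γ
  | center : LocalVertex Y γ
  | lower {τ : Y.V} (b : Y.Edge γ τ) : LocalVertex Y γ

/-- Edges of the local scwol `Y(γ)`: the pairs `(c, d)` of the upper link, from `cd` to `c`;
`γ*c` from `c` to `γ`; `b*c` from `c` to `b`; `b*γ` from `γ` to `b`; and the pairs `(a, b)` of the
lower link, from `b` to `ab`. -/
def LocalEdge (Y : Scwol.{u, v}) (γ : Y.V) : Y.LocalVertex γ → Y.LocalVertex γ → Type v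
  | .upper (σ := σ') c', .upper (σ := σ) c => {d : Y.Edge σ' σ // Y.comp c d = c'}
  | .upper _, .center => PUnit
  | .upper _, .lower _ => PUnit
  | .center, .lower _ => PUnit
  | .lower (τ := τ) b, .lower (τ := τ') b' => {a : Y.Edge τ τ' // Y.comp a b = b'}
  | .center, .upper _ => PEmpty
  | .center, .center => PEmpty
  | .lower _, .upper _ => PEmpty
  | .lower _, .center => PEmpty

/-- Composition in the local scwol. -/
def localComp (Y : Scwol.{u, v}) (γ : Y.V) : ∀ {x y z : Y.LocalVertex γ},
    Y.LocalEdge γ y z → Y.LocalEdge γ x y → Y.LocalEdge γ x z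
  | .upper _, .upper _, .upper _, ⟨d, hd⟩, ⟨d', hd'⟩ =>
      ⟨Y.comp d d', by rw [← Y.assoc, hd, hd']⟩
  | .upper _, .upper _, .center, _, _ => PUnit.unit
  | .upper _, .upper _, .lower _, _, _ => PUnit.unit
  | .upper _, .center, .lower _, _, _ => PUnit.unit
  | .upper _, .lower _, .lower _, _, _ => PUnit.unit
  | .center, .lower _, .lower _, _, _ => PUnit.unit
  | .lower _, .lower _, .lower _, ⟨a, ha⟩, ⟨a', ha'⟩ =>
      ⟨Y.comp a a', by rw [Y.assoc, ha', ha]⟩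

/-- The local scwol `Y(γ)`. -/
def localScwol (Y : Scwol.{u, v}) (γ : Y.V) : Scwol.{max u v, v} where
  V := Y.LocalVertex γ
  Edge := Y.LocalEdge γ
  comp := Y.localComp γ
  assoc {σ τ ρ μ} a b c := by
    cases σ <;> cases τ <;> cases ρ <;> cases μ <;> first
      | exact a.elim
      | exact b.elim
      | exact c.elim
      | rfl
      | exact Subtype.ext (Y.assoc _ _ _)
  loopless σ := by
    cases σ with
    | upper c => exact ⟨fun d => (Y.loopless _).false d.1⟩
    | center => exact ⟨fun d => d.elim⟩
    | lower b => exact ⟨fun a => (Y.loopless _).false a.1⟩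

/-- The morphism `h : Y(γ) → Y` on objects: `c ↦ i(c)`, `γ ↦ γ`, `b ↦ t(b)`. -/
def localObj (Y : Scwol.{u, v}) (γ : Y.V) : Y.LocalVertex γ → Y.V
  | .upper (σ := σ) _ => σ
  | .center => γ
  | .lower (τ := τ) _ => τ

/-- The morphism `h : Y(γ) → Y` on edges: `(c, d) ↦ d`, `γ*c ↦ c`, `b*c ↦ bc`, `b*γ ↦ b`,
`(a, b) ↦ a`. -/
def localMap (Y : Scwol.{u, v}) (γ : Y.V) : ∀ {x y : Y.LocalVertex γ},
    Y.LocalEdge γ x y → Y.Edge (Y.localObj γ x) (Y.localObj γ y)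
  | .upper _, .upper _, d => d.1
  | .upper c, .center, _ => c
  | .upper c, .lower b, _ => Y.comp b c
  | .center, .lower b, _ => b
  | .lower _, .lower _, a => a.1

/-- The morphism of scwols `h : Y(γ) → Y`. -/
def localHom (Y : Scwol.{u, v}) (γ : Y.V) : (Y.localScwol γ).Hom Y where
  obj := Y.localObj γ
  map := Y.localMap γ
  map_comp {σ τ ρ} a b := by
    cases σ <;> cases τ <;> cases ρ <;> first
      | exact a.elim
      | exact b.elim
      | rfl
      | exact a.2.symm
      | exact b.2.symm
      | (obtain ⟨b, rfl⟩ := b; exact (Y.assoc _ _ _).symm)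
      | (obtain ⟨a, rfl⟩ := a; exact Y.assoc _ _ _)

end Scwol

namespace ComplexOfGroups

variable {Y : Scwol.{u, v}} (G : ComplexOfGroups.{u, v, w} Y) (γ : Y.V)

/-- Local groups of `L(Y(γ))`: `L_c = G_{i(c)}`, `L_γ = G_γ`, `L_b = G_γ`. -/
def localGrp : Y.LocalVertex γ → Type w
  | .upper (σ := σ) _ => G.grp σ
  | .center => G.grp γ
  | .lower _ => G.grp γ

instance localGrpGroup : ∀ x : Y.LocalVertex γ, Group (G.localGrp γ x)
  | .upper (σ := σ) _ => G.inst σ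
  | .center => G.inst γ
  | .lower _ => G.inst γ

/-- The homomorphisms of `L(Y(γ))`: `ψ_d` over `(c, d)`, `ψ_c` over `γ*c` and `b*c`, the identity
over `b*γ` and `(a, b)`. -/
def localψ : ∀ {x y : Y.LocalVertex γ}, Y.LocalEdge γ x y → G.localGrp γ x →* G.localGrp γ y
  | .upper _, .upper _, d => G.ψ d.1
  | .upper c, .center, _ => G.ψ c
  | .upper c, .lower _, _ => G.ψ c
  | .center, .lower _, _ => MonoidHom.id (G.grp γ)
  | .lower _, .lower _, _ => MonoidHom.id (G.grp γ)

/-- The twisting elements of `L(Y(γ))`: `g_{d₁,d₂}` for `((c₁,d₁),(c₂,d₂))`; `g_{c,d}` for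
`(γ*c,(c,d))` and `(b*c,(c,d))`; trivial otherwise. -/
def localTw : ∀ {x y z : Y.LocalVertex γ},
    Y.LocalEdge γ y z → Y.LocalEdge γ x y → G.localGrp γ z
  | .upper _, .upper _, .upper _, d₁, d₂ => G.tw d₁.1 d₂.1
  | .upper _, .upper c, .center, _, d => G.tw c d.1
  | .upper _, .upper c, .lower _, _, d => G.tw c d.1
  | .upper _, .center, .lower _, _, _ => (1 : G.grp γ)
  | .upper _, .lower _, .lower _, _, _ => (1 : G.grp γ)
  | .center, .lower _, .lower _, _, _ => (1 : G.grp γ)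
  | .lower _, .lower _, .lower _, _, _ => (1 : G.grp γ)

theorem one_mul_mul_inv_one {M : Type w} [Group M] (m : M) : 1 * m * 1⁻¹ = m := by simp

/-- The local complex of groups `L(Y(γ))` over the local scwol `Y(γ)`. -/
def localComplex : ComplexOfGroups.{max u v, v, w} (Y.localScwol γ) where
  grp := G.localGrp γ
  inst := G.localGrpGroup γ
  ψ := G.localψ γ
  ψ_injective {σ τ} a := by
    cases σ <;> cases τ <;> first
      | exact a.elim
      | exact G.ψ_injective _
      | exact fun _ _ h => h
  tw := G.localTw γ
  ad_tw {σ τ ρ} a b x := by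
    cases σ <;> cases τ <;> cases ρ <;> first
      | exact a.elim
      | exact b.elim
      | exact G.ad_tw _ _ _
      | (obtain ⟨b, rfl⟩ := b; exact G.ad_tw _ _ _)
      | exact one_mul_mul_inv_one (M := G.grp γ) _
  cocycle {σ τ ρ μ} a b c := by
    cases σ <;> cases τ <;> cases ρ <;> cases μ <;> first
      | exact a.elim
      | exact b.elim
      | exact c.elim
      | exact G.cocycle _ _ _
      | (obtain ⟨b, rfl⟩ := b; exact G.cocycle _ _ _)
      | exact (mul_one (M := G.grp γ) _).trans (one_mul (M := G.grp γ) _).symm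

/-- Local homomorphisms of `Σ`: the identity of `G_{i(c)}` at `c`, the identity of `G_γ` at `γ`,
and `ψ_b` at `b`. -/
def sigmaLoc : ∀ x : Y.LocalVertex γ, G.localGrp γ x →* G.grp (Y.localObj γ x)
  | .upper (σ := σ) _ => MonoidHom.id (G.grp σ)
  | .center => MonoidHom.id (G.grp γ)
  | .lower b => G.ψ b

/-- The elements `Σ(u)`: `g_{b,c}` for `b*c`, `g_{a,b}⁻¹` for `(a, b)`, trivial otherwise. -/
def sigmaElt : ∀ {x y : Y.LocalVertex γ}, Y.LocalEdge γ x y → G.grp (Y.localObj γ y)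
  | .upper _, .upper (σ := σ) _, _ => (1 : G.grp σ)
  | .upper _, .center, _ => (1 : G.grp γ)
  | .upper c, .lower b, _ => G.tw b c
  | .center, .lower (τ := τ) _, _ => (1 : G.grp τ)
  | .lower b, .lower _, a => (G.tw a.1 b)⁻¹

theorem inv_ad_tw {σ τ ρ : Y.V} (a : Y.Edge τ ρ) (b : Y.Edge σ τ) (x : G.grp σ) :
    (G.tw a b)⁻¹ * G.ψ a (G.ψ b x) * (G.tw a b)⁻¹⁻¹ = G.ψ (Y.comp a b) x := by
  rw [← G.ad_tw]
  group

/-- The canonical morphism `Σ : L(Y(γ)) → G(Y)` over `h : Y(γ) → Y`. -/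
def sigma : Hom (Y.localHom γ) (G.localComplex γ) G where
  loc := G.sigmaLoc γ
  elt := G.sigmaElt γ
  ad_elt {σ τ} a x := by
    cases σ <;> cases τ <;> first
      | exact a.elim
      | exact one_mul_mul_inv_one _
      | exact G.ad_tw _ _ _
      | (obtain ⟨a, rfl⟩ := a; exact G.inv_ad_tw _ _ _)
  elt_comp {σ τ ρ} a b := by
    cases σ with
    | upper c₂ =>
      cases τ with
      | upper c =>
        obtain ⟨d, rfl⟩ := b
        cases ρ with
        | upper c' =>
          obtain ⟨d', rfl⟩ := a
          change G.tw d' d * 1 = 1 * G.ψ d' 1 * G.tw d' d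
          simp
        | center =>
          change G.tw c d * 1 = 1 * G.ψ c 1 * G.tw c d
          simp
        | lower b =>
          change G.ψ b (G.tw c d) * G.tw b (Y.comp c d)
            = G.tw b c * G.ψ (Y.comp b c) 1 * G.tw (Y.comp b c) d
          rw [G.cocycle, map_one, mul_one]
      | center =>
        cases ρ with
        | upper _ => exact a.elim
        | center => exact a.elim
        | lower b =>
          change G.ψ b 1 * G.tw b c₂ = 1 * G.ψ b 1 * G.tw b c₂
          simp
      | lower b₁ =>
        cases ρ with
        | upper _ => exact a.elim
        | center => exact a.elim
        | lower b' =>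
          obtain ⟨a, rfl⟩ := a
          change G.ψ (Y.comp a b₁) 1 * G.tw (Y.comp a b₁) c₂
            = (G.tw a b₁)⁻¹ * G.ψ a (G.tw b₁ c₂) * G.tw a (Y.comp b₁ c₂)
          rw [mul_assoc, G.cocycle, map_one, one_mul, inv_mul_cancel_left]
    | center =>
      cases τ with
      | upper _ => exact b.elim
      | center => exact b.elim
      | lower b₁ =>
        cases ρ with
        | upper _ => exact a.elim
        | center => exact a.elim
        | lower b' =>
          obtain ⟨a, rfl⟩ := a
          change G.ψ (Y.comp a b₁) 1 * 1 = (G.tw a b₁)⁻¹ * G.ψ a 1 * G.tw a b₁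
          simp
    | lower b₂ =>
      cases τ with
      | upper _ => exact b.elim
      | center => exact b.elim
      | lower b₁ =>
        cases ρ with
        | upper _ => exact a.elim
        | center => exact a.elim
        | lower b' =>
          obtain ⟨a₂, rfl⟩ := b
          obtain ⟨a₁, rfl⟩ := a
          change G.ψ (Y.comp a₁ (Y.comp a₂ b₂)) 1 * (G.tw (Y.comp a₁ a₂) b₂)⁻¹
            = (G.tw a₁ (Y.comp a₂ b₂))⁻¹ * G.ψ a₁ (G.tw a₂ b₂)⁻¹ * G.tw a₁ a₂
          have h := G.cocycle a₁ a₂ b₂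
          rw [map_one, one_mul, map_inv, ← mul_inv_rev, h]
          group

end ComplexOfGroups

/-! Both conditions are equivalent to each local group `G_σ` embedding in the universal group
`FG(Y)`. For `Σ`: every object of `Y(γ)` is joined to `γ` by an edge, so `Y(γ)` is a cone, and
conjugating by these rays moves every loop of `L(Y(γ))` into `G_γ`. A retraction onto `G_γ` shows
that nothing is lost, and `Σ` is the natural map on `G_γ` (`sigma_isPiOneInjective_iff`). If `G(Y)`
comes from an action of `Γ`, then `g ↦ φ_σ(g)`, `a⁺ ↦ φ(a) h_a` defines a homomorphism `FG(Y) → Γ`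
that is injective on every `G_σ` (`IsDevelopable.ofGrp_injective`). Conversely, the fundamental
group at `σ₀` acts on the development, whose objects are the cosets `x G_σ` with `x` a path element
starting at `σ₀`. The quotient is `Y`, and the stabilizer of `x G_σ` is the conjugate by `x` of the
image of `G_σ`, so the associated complex is `G(Y)` once the local groups embed
(`devHom_bijective`). Simple connectedness is a monodromy argument. Fix an object `q` and consider
homotopy classes of edge paths ending at `q`, each marked by a representative `x` of its initial
coset. Right multiplication by local elements and prepending edges satisfy the relations of `FG(Y)`,
so `FG(Y)` acts. By `MarkedClass.perm_path`, the element `x⁻¹y` carries the constant path at `q`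
marked `y` to the class of any path to `q` marked `x`; as `x⁻¹y` does not involve the path, any two
paths with the same end points are homotopic. -/

namespace ComplexOfGroups

/-! ### The universal group and its path elements. -/

section Universal

variable {Y : Scwol.{u, v}} (G : ComplexOfGroups.{u, v, w} Y)

/-- The universal property of `FG(Y)`. -/
def universalLift {K : Type*} [Group K] (f : ∀ σ : Y.V, G.grp σ →* K)
    (e : ∀ {σ τ : Y.V}, Y.Edge σ τ → K)
    (hcomp : ∀ {σ τ ρ : Y.V} (a : Y.Edge τ ρ) (b : Y.Edge σ τ),
      e a * e b = f ρ (G.tw a b) * e (Y.comp a b))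
    (hconj : ∀ {σ τ : Y.V} (a : Y.Edge σ τ) (g : G.grp σ), e a * f σ g = f τ (G.ψ a g) * e a) :
    UniversalGroup G →* K :=
  PresentedGroup.toGroup
    (f := fun s : Gen G => match s with
      | .ofGrp (σ := σ) g => f σ g
      | .ofEdge a => e a) <| by
    rintro _ (⟨g, h⟩ | ⟨a, b⟩ | ⟨a, g⟩)
    · simp
    · simp only [map_mul, map_inv, FreeGroup.lift_apply_of]
      rw [mul_inv_eq_one, hcomp]
    · simp only [map_mul, map_inv, FreeGroup.lift_apply_of]
      rw [mul_inv_eq_one, hconj, mul_inv_cancel_right]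

section

variable {K : Type*} [Group K] {f : ∀ σ : Y.V, G.grp σ →* K}
  {e : ∀ {σ τ : Y.V}, Y.Edge σ τ → K}
  (hcomp : ∀ {σ τ ρ : Y.V} (a : Y.Edge τ ρ) (b : Y.Edge σ τ),
      e a * e b = f ρ (G.tw a b) * e (Y.comp a b))
  (hconj : ∀ {σ τ : Y.V} (a : Y.Edge σ τ) (g : G.grp σ), e a * f σ g = f τ (G.ψ a g) * e a)

@[simp] theorem universalLift_ofGrp (σ : Y.V) (g : G.grp σ) :
    G.universalLift f e hcomp hconj (G.ofGrp σ g) = f σ g :=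
  PresentedGroup.toGroup.of _

@[simp] theorem universalLift_ofEdge {σ τ : Y.V} (a : Y.Edge σ τ) :
    G.universalLift f e hcomp hconj (G.ofEdge a) = e a :=
  PresentedGroup.toGroup.of _

end

theorem ofEdge_mul_ofGrp {σ τ : Y.V} (a : Y.Edge σ τ) (g : G.grp σ) :
    G.ofEdge a * G.ofGrp σ g = G.ofGrp τ (G.ψ a g) * G.ofEdge a := by
  rw [← G.ofEdge_conj, inv_mul_cancel_right]

theorem isPathElt_ofEdge {σ τ : Y.V} (a : Y.Edge σ τ) : G.IsPathElt τ σ (G.ofEdge a) := by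
  have h := IsPathElt.pos (1 : G.grp τ) a (.nil (G := G) (1 : G.grp σ))
  rwa [map_one, map_one, one_mul, mul_one] at h

theorem isPathElt_ofEdge_inv {σ τ : Y.V} (a : Y.Edge σ τ) :
    G.IsPathElt σ τ (G.ofEdge a)⁻¹ :=
  (G.isPathElt_ofEdge a).inv

theorem isPathElt_one (σ : Y.V) : G.IsPathElt σ σ 1 := (G.piOne σ).one_mem

theorem exists_isPathElt {σ τ : Y.V} (p : Y.Path σ τ) : ∃ x, G.IsPathElt σ τ x := by
  induction p with
  | nil σ => exact ⟨1, G.isPathElt_one σ⟩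
  | pos a _ ih => exact ⟨_, (G.isPathElt_ofEdge a).mul ih.choose_spec⟩
  | neg a _ ih => exact ⟨_, (G.isPathElt_ofEdge_inv a).mul ih.choose_spec⟩

end Universal

/-! ### Local complexes of groups: contracting the cone `Y(γ)` to `γ`. -/

section Local

variable {Y : Scwol.{u, v}} (G : ComplexOfGroups.{u, v, w} Y) (γ : Y.V)

/-- The homomorphisms of the retraction of `L(Y(γ))` onto `G_γ`. -/
def localRetractionLoc : ∀ x : (Y.localScwol γ).V, (G.localComplex γ).grp x →* G.grp γ
  | .upper c => G.ψ c
  | .center => MonoidHom.id (G.grp γ)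
  | .lower _ => MonoidHom.id (G.grp γ)

/-- The values on edges of the retraction of `L(Y(γ))` onto `G_γ`. -/
def localRetractionElt : ∀ {x y : (Y.localScwol γ).V}, (Y.localScwol γ).Edge x y → G.grp γ
  | .upper _, .upper c, d => G.tw c d.1
  | .upper _, .center, _ => 1
  | .upper _, .lower _, _ => 1
  | .center, .lower _, _ => 1
  | .lower _, .lower _, _ => 1

/-- In the upper link this is the cocycle identity of `G(Y)` at `γ`; in the other cases one factor
on each side is trivial. -/
theorem localRetraction_comp {x y z : (Y.localScwol γ).V} (a : (Y.localScwol γ).Edge y z)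
    (b : (Y.localScwol γ).Edge x y) :
    G.localRetractionElt γ a * G.localRetractionElt γ b =
      G.localRetractionLoc γ z ((G.localComplex γ).tw a b) *
        G.localRetractionElt γ ((Y.localScwol γ).comp a b) := by
  cases x <;> cases y <;> cases z <;> first
    | exact a.elim
    | exact b.elim
    | exact (one_mul (M := G.grp γ) _).trans (mul_one (M := G.grp γ) _).symm
    | (obtain ⟨a, rfl⟩ := a; exact (G.cocycle _ _ _).symm)

theorem localRetraction_conj {x y : (Y.localScwol γ).V} (a : (Y.localScwol γ).Edge x y)
    (g : (G.localComplex γ).grp x) :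
    G.localRetractionElt γ a * G.localRetractionLoc γ x g =
      G.localRetractionLoc γ y ((G.localComplex γ).ψ a g) * G.localRetractionElt γ a := by
  cases x <;> cases y <;> first
    | exact a.elim
    | exact (one_mul (M := G.grp γ) _).trans (mul_one (M := G.grp γ) _).symm
    | (obtain ⟨a, rfl⟩ := a; exact mul_inv_eq_iff_eq_mul.mp (G.ad_tw _ _ _))

/-- The retraction of the universal group of `L(Y(γ))` onto `G_γ`. -/
def localRetraction : UniversalGroup (G.localComplex γ) →* G.grp γ :=
  (G.localComplex γ).universalLift (G.localRetractionLoc γ) (G.localRetractionElt γ)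
    (G.localRetraction_comp γ) (G.localRetraction_conj γ)

/-- The natural homomorphism from `G_γ` to the universal group of `L(Y(γ))`. -/
def localCenter : G.grp γ →* UniversalGroup (G.localComplex γ) :=
  (G.localComplex γ).ofGrp .center

theorem localRetraction_localCenter (g : G.grp γ) :
    G.localRetraction γ (G.localCenter γ g) = g :=
  universalLift_ofGrp _ _ _ _ _

theorem sigma_localCenter (g : G.grp γ) :
    (G.sigma γ).onUniversal (G.localCenter γ g) = G.ofGrp γ g :=
  (G.sigma γ).onUniversal_ofGrp .center g

/-- The class in the universal group of `L(Y(γ))` of the edge from the cone point `γ` to `x`. -/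
def localRay : (Y.localScwol γ).V → UniversalGroup (G.localComplex γ)
  | .upper c => (G.localComplex γ).ofEdge (σ := .upper c) (τ := .center) PUnit.unit
  | .center => 1
  | .lower b => ((G.localComplex γ).ofEdge (σ := .center) (τ := .lower b) PUnit.unit)⁻¹

/-- Sliding a local element along the ray from `x` to the cone point applies the structure
homomorphism between them, which is the retraction. -/
theorem localRay_mul_ofGrp (x : (Y.localScwol γ).V) (g : (G.localComplex γ).grp x) :
    G.localRay γ x * (G.localComplex γ).ofGrp x g =
      G.localCenter γ (G.localRetractionLoc γ x g) * G.localRay γ x := by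
  cases x with
  | upper c => exact (G.localComplex γ).ofEdge_mul_ofGrp (σ := .upper c) (τ := .center) _ g
  | center => exact (one_mul _).trans (mul_one _).symm
  | lower b =>
    rw [localRay, inv_mul_eq_iff_eq_mul, ← mul_assoc, eq_mul_inv_iff_mul_eq]
    exact ((G.localComplex γ).ofEdge_mul_ofGrp (σ := .center) (τ := .lower b) _ g).symm

/-- The edge and the rays to its two ends bound a triangle with apex `γ`. The relation of this
triangle leaves an element of `G_γ`, which is non-trivial at most for edges of the upper link. -/
theorem localRay_mul_ofEdge {x y : (Y.localScwol γ).V} (a : (Y.localScwol γ).Edge x y) :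
    G.localRay γ y * (G.localComplex γ).ofEdge a =
      G.localCenter γ (G.localRetractionElt γ a) * G.localRay γ x := by
  have key {x y z : (Y.localScwol γ).V} (a : (Y.localScwol γ).Edge y z)
      (b : (Y.localScwol γ).Edge x y) (h : (G.localComplex γ).tw a b = 1) :
      (G.localComplex γ).ofEdge a * (G.localComplex γ).ofEdge b =
        (G.localComplex γ).ofEdge ((Y.localScwol γ).comp a b) := by
    rw [ofEdge_mul, h, map_one, one_mul]
  have hone (z : UniversalGroup (G.localComplex γ)) : G.localCenter γ 1 * z = z := by simp
  cases x <;> cases y <;> try exact a.elim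
  case upper.upper c' σ c =>
    exact (G.localComplex γ).ofEdge_mul (σ := .upper c') (τ := .upper c) (ρ := .center)
      PUnit.unit a
  case upper.center c =>
    exact (one_mul _).trans (hone _).symm
  case upper.lower c _ b =>
    refine inv_mul_eq_iff_eq_mul.mpr ?_
    exact (key (x := .upper c) (y := .center) (z := .lower b) PUnit.unit PUnit.unit
      rfl).symm.trans (congrArg _ (hone _).symm)
  case center.lower b =>
    exact (inv_mul_cancel _).trans (hone _).symm
  case lower.lower b' _ b =>
    rw [localRay, localRay, inv_mul_eq_iff_eq_mul, ← mul_assoc, eq_mul_inv_iff_mul_eq]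
    exact (key (x := .center) (y := .lower b') (z := .lower b) a PUnit.unit rfl).trans
      (mul_one _).symm |>.trans (congrArg _ (map_one _).symm)

/-- The cone contracts: pushing the ray through the path one letter at a time leaves only elements
of `G_γ` behind it. -/
theorem exists_localRay_mul {x y : (Y.localScwol γ).V} {z : UniversalGroup (G.localComplex γ)}
    (hz : (G.localComplex γ).IsPathElt x y z) :
    ∃ g : G.grp γ, G.localRay γ x * z = G.localCenter γ g * G.localRay γ y := by
  induction hz with
  | nil g => exact ⟨_, G.localRay_mul_ofGrp γ _ g⟩
  | @pos σ τ ρ g a z _ ih =>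
    obtain ⟨k, hk⟩ := ih
    refine ⟨G.localRetractionLoc γ τ g * (G.localRetractionElt γ a * k), ?_⟩
    rw [← mul_assoc, ← mul_assoc, localRay_mul_ofGrp, mul_assoc _ _ (ofEdge _ a),
      localRay_mul_ofEdge, map_mul, map_mul, mul_assoc, mul_assoc, hk]
    simp only [mul_assoc]
  | @neg σ τ ρ g a z _ ih =>
    obtain ⟨k, hk⟩ := ih
    refine ⟨G.localRetractionLoc γ σ g * ((G.localRetractionElt γ a)⁻¹ * k), ?_⟩
    have h : G.localRay γ σ * (ofEdge _ a)⁻¹ =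
        (G.localCenter γ (G.localRetractionElt γ a))⁻¹ * G.localRay γ τ := by
      rw [mul_inv_eq_iff_eq_mul, mul_assoc, localRay_mul_ofEdge, inv_mul_cancel_left]
    rw [← mul_assoc, ← mul_assoc, localRay_mul_ofGrp, mul_assoc _ _ (ofEdge _ a)⁻¹, h,
      map_mul, map_mul, map_inv, mul_assoc, mul_assoc, hk]
    simp only [mul_assoc]

/-- The canonical morphism `Σ : L(Y(γ)) → G(Y)` is `π₁`-injective exactly if `G_γ` embeds in the
universal group of `G(Y)`. -/
theorem sigma_isPiOneInjective_iff :
    (G.sigma γ).IsPiOneInjective ↔ Function.Injective (G.ofGrp γ) := by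
  constructor
  · intro h
    rw [injective_iff_map_eq_one]
    intro g hg
    -- Injectivity is tested at the cone point, on the loop without edges given by `g`; the
    -- retraction then recovers `g`.
    have h1 := (injective_iff_map_eq_one _).mp (h .center)
      ⟨G.localCenter γ g, IsPathElt.nil (G := G.localComplex γ) (σ := .center) g⟩
      (Subtype.ext ((G.sigma_localCenter γ g).trans hg))
    rw [← G.localRetraction_localCenter γ g]
    exact (congrArg _ (congrArg Subtype.val h1)).trans (map_one _)
  · intro h x
    rw [injective_iff_map_eq_one]
    rintro ⟨z, hz⟩ hz1
    -- The loop `z` is the conjugate by the ray of some `g` in `G_γ`. Applying `Σ` cancels the ray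
    -- and forces the image of `g` to be trivial.
    obtain ⟨g, hg⟩ := G.exists_localRay_mul γ hz
    have hz2 : (G.sigma γ).onUniversal z = 1 := congrArg Subtype.val hz1
    have h2 := congrArg (G.sigma γ).onUniversal hg
    rw [map_mul, map_mul, hz2, mul_one, right_eq_mul, sigma_localCenter] at h2
    rw [(injective_iff_map_eq_one _).mp h g h2, map_one, one_mul, mul_eq_left] at hg
    exact Subtype.ext hg

end Local

/-! ### Developability makes the local groups embed. -/

/-- The composite `G_σ → FG(Y) → Γ` is `φ_σ` followed by the inclusion of the stabilizer. The
relations of `FG(Y)` hold in `Γ` because they are the axioms of a morphism with `ψ_a` and `g_{a,b}`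
expressed through the `h_a`. -/
theorem IsDevelopable.ofGrp_injective {Y : Scwol.{u, v}} {G : ComplexOfGroups.{u, v, w} Y}
    (hG : G.IsDevelopable) (σ : Y.V) : Function.Injective (G.ofGrp σ) := by
  obtain ⟨X, Γ, _, A, Q, L, -, φ, hφ⟩ := hG
  let F : UniversalGroup G →* Γ :=
    G.universalLift (fun σ => (A.stab (L.vert σ)).subtype.comp (φ.loc σ))
      (fun {_ τ} a => (φ.elt a : A.stab (L.vert τ)).1 * L.h a)
      (by
        intro σ τ ρ a b
        have h : (φ.loc ρ (G.tw a b)).1 * (φ.elt (Y.comp a b)).1 =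
            (φ.elt a).1 * (L.h a * (φ.elt b).1 * (L.h a)⁻¹) *
              (L.h a * L.h b * (L.h (Y.comp a b))⁻¹) :=
          congrArg Subtype.val (φ.elt_comp a b)
        change _ = (φ.loc ρ (G.tw a b)).1 * _
        rw [← mul_assoc _ _ (L.h (Y.comp a b)), h]
        group)
      (by
        intro σ τ a g
        have h : (φ.elt a).1 * (L.h a * (φ.loc σ g).1 * (L.h a)⁻¹) * (φ.elt a).1⁻¹ =
            (φ.loc τ (G.ψ a g)).1 :=
          congrArg Subtype.val (φ.ad_elt a g)
        change _ = (φ.loc τ (G.ψ a g)).1 * _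
        rw [← h]
        change _ * (φ.loc σ g).1 = _
        group)
  intro g g' h
  refine (hφ σ).1 (Subtype.ext ?_)
  have h' := congrArg F h
  rwa [universalLift_ofGrp, universalLift_ofGrp] at h'

end ComplexOfGroups

/-! ### The development and the action of the fundamental group. -/

namespace ComplexOfGroups

section Development

variable {Y : Scwol.{u, v}} (G : ComplexOfGroups.{u, v, w} Y)

/-- The left cosets of the image of `G_σ` in `FG(Y)`. -/
abbrev Cosets (σ : Y.V) : Type (max u v w) := UniversalGroup G ⧸ (G.ofGrp σ).range

/-- The map `x G_σ ↦ x a⁻ G_τ` on cosets given by an edge `a` from `σ` to `τ`. -/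
def cosetShift {σ τ : Y.V} (a : Y.Edge σ τ) : G.Cosets σ → G.Cosets τ :=
  Quotient.map' (fun x => x * (G.ofEdge a)⁻¹) <| by
    intro x y h
    rw [QuotientGroup.leftRel_apply] at h ⊢
    obtain ⟨g, hg⟩ := h
    -- Two representatives differ by `g` on the right, and `g a⁻ = a⁻ ψ_a(g)`.
    refine ⟨G.ψ a g, ?_⟩
    rw [← ofEdge_conj, hg]
    group

@[simp] theorem cosetShift_mk {σ τ : Y.V} (a : Y.Edge σ τ) (x : UniversalGroup G) :
    G.cosetShift a (QuotientGroup.mk x) = QuotientGroup.mk (x * (G.ofEdge a)⁻¹) := rfl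

theorem mk_mul_ofGrp {σ : Y.V} (x : UniversalGroup G) (g : G.grp σ) :
    (QuotientGroup.mk (x * G.ofGrp σ g) : G.Cosets σ) = QuotientGroup.mk x :=
  QuotientGroup.mk_mul_of_mem _ ⟨g, rfl⟩

theorem exists_of_mk_eq {σ : Y.V} {x y : UniversalGroup G}
    (h : (QuotientGroup.mk x : G.Cosets σ) = QuotientGroup.mk y) :
    ∃ g : G.grp σ, y = x * G.ofGrp σ g := by
  obtain ⟨g, hg⟩ := QuotientGroup.eq.mp h
  exact ⟨g, by rw [hg, mul_inv_cancel_left]⟩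

/-- Since `b⁻a⁻ = (ab)⁻ g_{a,b}⁻¹`, the twisting element is absorbed by the coset of `G_ρ`. This is
why edges of the development compose without twist. -/
theorem cosetShift_comp {σ τ ρ : Y.V} (a : Y.Edge τ ρ) (b : Y.Edge σ τ) (C : G.Cosets σ) :
    G.cosetShift (Y.comp a b) C = G.cosetShift a (G.cosetShift b C) := by
  induction C using QuotientGroup.induction_on with
  | H x =>
    rw [cosetShift_mk, cosetShift_mk, cosetShift_mk, mul_assoc, ← mul_inv_rev, ofEdge_mul,
      mul_inv_rev, ← mul_assoc, ← map_inv, mk_mul_ofGrp]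

theorem smul_cosetShift {σ τ : Y.V} (a : Y.Edge σ τ) (g : UniversalGroup G) (C : G.Cosets σ) :
    G.cosetShift a (g • C) = g • G.cosetShift a C := by
  induction C using QuotientGroup.induction_on with
  | H x =>
    change (QuotientGroup.mk (g * x * _) : G.Cosets τ) = QuotientGroup.mk (g * (x * _))
    rw [mul_assoc]

variable (σ₀ : Y.V)

/-- The cosets `x G_σ` where `x` is represented by a `G(Y)`-path from `σ₀` to `σ`. -/
def PathCosets (σ : Y.V) : Type (max u v w) :=
  {C : G.Cosets σ // ∃ x, G.IsPathElt σ₀ σ x ∧ QuotientGroup.mk x = C}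

/-- The development of `G(Y)`: its objects over `σ` are the cosets `x G_σ` where `x` is represented
by a `G(Y)`-path from `σ₀` to `σ`, its edges over `a` go from `x G_{i(a)}` to `x a⁻ G_{t(a)}`. -/
def development : Scwol.{max u v w, v} where
  V := Σ σ : Y.V, G.PathCosets σ₀ σ
  Edge p q := {a : Y.Edge p.1 q.1 // G.cosetShift a p.2.1 = q.2.1}
  comp a b := ⟨Y.comp a.1 b.1, by rw [cosetShift_comp, b.2, a.2]⟩
  assoc a b c := Subtype.ext (Y.assoc _ _ _)
  loopless p := ⟨fun a => (Y.loopless p.1).false a.1⟩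

variable {σ₀} in
/-- The object `x G_σ` of the development. -/
def devObj {σ : Y.V} {x : UniversalGroup G} (hx : G.IsPathElt σ₀ σ x) :
    (G.development σ₀).V :=
  ⟨σ, QuotientGroup.mk x, x, hx, rfl⟩

variable {G σ₀}

theorem devObj_eq {σ : Y.V} {x y : UniversalGroup G} (hx : G.IsPathElt σ₀ σ x)
    (hy : G.IsPathElt σ₀ σ y) (h : (QuotientGroup.mk x : G.Cosets σ) = QuotientGroup.mk y) :
    G.devObj hx = G.devObj hy :=
  Sigma.ext rfl (heq_of_eq (Subtype.ext h))

/-- The edge over `a` with a given source. -/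
def devEdge {σ τ : Y.V} (a : Y.Edge σ τ) {x : UniversalGroup G} (hx : G.IsPathElt σ₀ σ x) :
    (G.development σ₀).Edge (G.devObj hx) (G.devObj (hx.mul (G.isPathElt_ofEdge_inv a))) :=
  ⟨a, rfl⟩

/-- The target coset is determined by the source and the edge of `Y`, so choosing a representative
of the source suffices. -/
theorem exists_devEdge (e : (G.development σ₀).E) :
    ∃ (σ τ : Y.V) (a : Y.Edge σ τ) (x : UniversalGroup G) (hx : G.IsPathElt σ₀ σ x),
      e = ⟨_, _, devEdge a hx⟩ := by
  obtain ⟨⟨σ, C, x, hx, rfl⟩, ⟨τ, D⟩, a, ha⟩ := e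
  change Y.Edge σ τ at a
  obtain rfl : D = ⟨_, _, hx.mul (G.isPathElt_ofEdge_inv a), rfl⟩ := Subtype.ext ha.symm
  exact ⟨σ, τ, a, x, hx, rfl⟩

theorem devEdge_eq {σ τ : Y.V} (a : Y.Edge σ τ) {x y : UniversalGroup G}
    (hx : G.IsPathElt σ₀ σ x) (hy : G.IsPathElt σ₀ σ y)
    (h : (QuotientGroup.mk x : G.Cosets σ) = QuotientGroup.mk y) :
    (⟨_, _, devEdge a hx⟩ : (G.development σ₀).E) = ⟨_, _, devEdge a hy⟩ := by
  -- The cosets become variables so that equalities of end points can be substituted in the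
  -- dependent type of edges.
  have key (C D : G.PathCosets σ₀ σ) (C' D' : G.PathCosets σ₀ τ)
      (hC : G.cosetShift a C.1 = C'.1) (hD : G.cosetShift a D.1 = D'.1) (h : C.1 = D.1) :
      (⟨⟨σ, C⟩, ⟨τ, C'⟩, a, hC⟩ : (G.development σ₀).E) = ⟨⟨σ, D⟩, ⟨τ, D'⟩, a, hD⟩ := by
    obtain rfl : C = D := Subtype.ext h
    obtain rfl : C' = D' := Subtype.ext (hC.symm.trans hD)
    rfl
  exact key _ _ _ _ rfl rfl h

variable (G σ₀)

/-- The projection of the development to `Y`. -/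
def devProj : (G.development σ₀).Hom Y where
  obj p := p.1
  map a := a.1
  map_comp _ _ := rfl

/-- Left multiplication on the development. -/
def devMul (g : G.piOne σ₀) : (G.development σ₀).Hom (G.development σ₀) where
  obj p := ⟨p.1, g.1 • p.2.1, by
    obtain ⟨x, hx, h⟩ := p.2.2
    exact ⟨g.1 * x, IsPathElt.mul g.2 hx, by rw [← h]; rfl⟩⟩
  map a := ⟨a.1, by rw [smul_cosetShift, a.2]⟩
  map_comp _ _ := rfl

/-- Comparing only underlying edges of `Y` makes the second condition hold by reflexivity for left
multiplications, which do not change them. -/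
theorem dev_hom_ext {f g : (G.development σ₀).Hom (G.development σ₀)}
    (h : ∀ p, (f.obj p) = (g.obj p))
    (h' : ∀ (p q : (G.development σ₀).V) (a : (G.development σ₀).Edge p q),
      HEq (f.map a).1 (g.map a).1) : f = g := by
  obtain ⟨fo, fm, _⟩ := f
  obtain ⟨go, gm, _⟩ := g
  obtain rfl : fo = go := funext h
  congr 1
  ext p q a
  exact Subtype.ext (eq_of_heq (h' p q a))

theorem devMul_devEdge (g : G.piOne σ₀) {σ τ : Y.V} (a : Y.Edge σ τ) {x : UniversalGroup G}
    (hx : G.IsPathElt σ₀ σ x) :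
    (G.devMul σ₀ g).onE ⟨_, _, devEdge a hx⟩ = ⟨_, _, devEdge a (IsPathElt.mul g.2 hx)⟩ := by
  have key (C : G.PathCosets σ₀ σ) (C' D' : G.PathCosets σ₀ τ)
      (hC : G.cosetShift a C.1 = C'.1) (hD : G.cosetShift a C.1 = D'.1) :
      (⟨⟨σ, C⟩, ⟨τ, C'⟩, a, hC⟩ : (G.development σ₀).E) = ⟨⟨σ, C⟩, ⟨τ, D'⟩, a, hD⟩ := by
    obtain rfl : C' = D' := Subtype.ext (hC.symm.trans hD)
    rfl
  exact key _ _ _ _ _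

/-- The action of the fundamental group on the development. -/
def devAction : Scwol.Action (G.piOne σ₀) (G.development σ₀) where
  act :=
    { toFun := G.devMul σ₀
      map_one' := G.dev_hom_ext σ₀
        (fun p => Sigma.ext rfl (heq_of_eq (Subtype.ext (one_smul _ _)))) fun _ _ _ => HEq.rfl
      map_mul' := fun g h => G.dev_hom_ext σ₀
        (fun p => Sigma.ext rfl (heq_of_eq (Subtype.ext (mul_smul _ _ _)))) fun _ _ _ => HEq.rfl }
  no_inversion g e h := by
    obtain ⟨σ, τ, a, x, hx, rfl⟩ := exists_devEdge e
    -- The action preserves the projection to `Y`, so an inversion would give a loop in `Y`.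
    obtain rfl : σ = τ := congrArg Sigma.fst h
    exact (Y.loopless σ).false a
  fix_edge g e h := by
    obtain ⟨σ, τ, a, x, hx, rfl⟩ := exists_devEdge e
    refine (G.devMul_devEdge σ₀ g a hx).trans (devEdge_eq a _ _ ?_)
    exact congrArg Subtype.val (eq_of_heq (Sigma.ext_iff.mp h).2)

theorem devAction_obj_eq (g : G.piOne σ₀) {σ : Y.V} {x y : UniversalGroup G}
    (hx : G.IsPathElt σ₀ σ x) (hy : G.IsPathElt σ₀ σ y)
    (h : (QuotientGroup.mk (g.1 * x) : G.Cosets σ) = QuotientGroup.mk y) :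
    ((G.devAction σ₀).act g).obj (G.devObj hx) = G.devObj hy :=
  devObj_eq (IsPathElt.mul g.2 hx) hy h

variable {G σ₀} in
theorem mk_eq_of_devObj_eq {σ : Y.V} {x y : UniversalGroup G} {hx : G.IsPathElt σ₀ σ x}
    {hy : G.IsPathElt σ₀ σ y} (h : G.devObj hx = G.devObj hy) :
    (QuotientGroup.mk x : G.Cosets σ) = QuotientGroup.mk y :=
  congrArg Subtype.val (eq_of_heq (Sigma.ext_iff.mp h).2)

/-- The quotient of the development by the fundamental group is `Y`. -/
def devQuotientMap (hY : Y.IsConnected) : (G.devAction σ₀).QuotientMap Y where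
  p := G.devProj σ₀
  obj_surjective σ := by
    obtain ⟨p⟩ := hY.2 σ₀ σ
    obtain ⟨x, hx⟩ := G.exists_isPathElt p
    exact ⟨G.devObj hx, rfl⟩
  onE_surjective := by
    rintro ⟨σ, τ, a⟩
    obtain ⟨p⟩ := hY.2 σ₀ σ
    obtain ⟨x, hx⟩ := G.exists_isPathElt p
    exact ⟨⟨_, _, devEdge a hx⟩, rfl⟩
  obj_eq_iff p q := by
    constructor
    · intro h
      obtain ⟨σ, C, x, hx, rfl⟩ := p
      obtain ⟨τ, D, y, hy, rfl⟩ := q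
      obtain rfl : σ = τ := h
      -- Two path elements with the same end points differ on the left by a loop at `σ₀`.
      exact ⟨⟨y * x⁻¹, hy.mul hx.inv⟩, G.devAction_obj_eq σ₀ _ hx hy
        (congrArg QuotientGroup.mk (inv_mul_cancel_right y x))⟩
    · rintro ⟨g, rfl⟩
      rfl
  onE_eq_iff e e' := by
    obtain ⟨σ, τ, a, x, hx, rfl⟩ := exists_devEdge e
    obtain ⟨σ', τ', a', y, hy, rfl⟩ := exists_devEdge e'
    constructor
    · intro h
      have h' : (⟨σ, τ, a⟩ : Y.E) = ⟨σ', τ', a'⟩ := h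
      cases h'
      exact ⟨⟨y * x⁻¹, hy.mul hx.inv⟩, (G.devMul_devEdge σ₀ _ a hx).trans
        (devEdge_eq a _ hy (by rw [inv_mul_cancel_right]))⟩
    · rintro ⟨g, hg⟩
      rw [← hg]
      rfl

/-! ### Recovering `G(Y)` from its development. -/

section Lifts

variable (hY : Y.IsConnected) {s : Y.V → UniversalGroup G} (hs : ∀ σ, G.IsPathElt σ₀ σ (s σ))

/-- The lifts given by a choice of `G(Y)`-paths from `σ₀` to all objects. -/
def devLifts : (G.devQuotientMap σ₀ hY).Lifts where
  vert σ := G.devObj (hs σ)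
  p_vert _ := rfl
  tgt {σ _} a := G.devObj ((hs σ).mul (G.isPathElt_ofEdge_inv a))
  edge {σ _} a := devEdge a (hs σ)
  p_edge _ := rfl
  -- The loop at `σ₀` that goes out to `τ`, along `a⁺` and back from `σ`; it carries `s_σ a⁻ G_τ` to
  -- `s_τ G_τ`.
  h {σ τ} a := ⟨s τ * G.ofEdge a * (s σ)⁻¹,
    ((hs τ).mul (G.isPathElt_ofEdge a)).mul (hs σ).inv⟩
  h_tgt {σ τ} a := G.devAction_obj_eq σ₀ _ _ (hs τ) (congrArg QuotientGroup.mk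
    (show s τ * G.ofEdge a * (s σ)⁻¹ * (s σ * (G.ofEdge a)⁻¹) = s τ by group))

theorem devLifts_mem_stab (σ : Y.V) (g : G.grp σ) :
    (⟨s σ * G.ofGrp σ g * (s σ)⁻¹, ((hs σ).mul (.nil g)).mul (hs σ).inv⟩ : G.piOne σ₀) ∈
      (G.devAction σ₀).stab (G.devObj (hs σ)) :=
  G.devAction_obj_eq σ₀ _ (hs σ) (hs σ) <| (congrArg QuotientGroup.mk (inv_mul_cancel_right _ (s σ))).trans
    (G.mk_mul_ofGrp (s σ) g)

/-- The morphism from `G(Y)` to the complex of groups associated to its development. -/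
def devHom : Hom (Scwol.Hom.id Y) G (G.devLifts σ₀ hY hs).complex where
  loc σ := MonoidHom.mk'
    (fun g => ⟨⟨s σ * G.ofGrp σ g * (s σ)⁻¹, _⟩, G.devLifts_mem_stab σ₀ hs σ g⟩) <| by
      intro g g'
      refine Subtype.ext (Subtype.ext ?_)
      change s σ * G.ofGrp σ (g * g') * (s σ)⁻¹ =
        s σ * G.ofGrp σ g * (s σ)⁻¹ * (s σ * G.ofGrp σ g' * (s σ)⁻¹)
      rw [map_mul]
      group
  -- Conjugation by the `s_σ` turns `ψ_a` into conjugation by `h_a` and `g_{a,b}` into `h_a h_b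
  -- h_{ab}⁻¹`, so no correction is needed.
  elt {σ τ} _ := (1 : (G.devLifts σ₀ hY hs).complex.grp τ)
  ad_elt {σ τ} a x := by
    refine Subtype.ext (Subtype.ext ?_)
    change 1 * (s τ * G.ofEdge a * (s σ)⁻¹ * (s σ * G.ofGrp σ x * (s σ)⁻¹) *
      (s τ * G.ofEdge a * (s σ)⁻¹)⁻¹) * 1⁻¹ = s τ * G.ofGrp τ (G.ψ a x) * (s τ)⁻¹
    rw [← ofEdge_conj]
    group
  elt_comp {σ τ ρ} a b := by
    refine Subtype.ext (Subtype.ext ?_)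
    change s ρ * G.ofGrp ρ (G.tw a b) * (s ρ)⁻¹ * 1 =
      1 * (s ρ * G.ofEdge a * (s τ)⁻¹ * 1 * (s ρ * G.ofEdge a * (s τ)⁻¹)⁻¹) *
        (s ρ * G.ofEdge a * (s τ)⁻¹ * (s τ * G.ofEdge b * (s σ)⁻¹) *
          (s ρ * G.ofEdge (Y.comp a b) * (s σ)⁻¹)⁻¹)
    rw [eq_mul_inv_of_mul_eq (G.ofEdge_mul a b).symm]
    group

/-- Surjectivity holds for any complex of groups, since `z s_σ G_σ = s_σ G_σ` puts `z` in `s_σ G_σ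
s_σ⁻¹`. The embedding of `G_σ` in `FG(Y)` gives injectivity. -/
theorem devHom_bijective (σ : Y.V) (hσ : Function.Injective (G.ofGrp σ)) :
    Function.Bijective ((G.devHom σ₀ hY hs).loc σ) := by
  constructor
  · intro g g' h
    have h' : s σ * G.ofGrp σ g * (s σ)⁻¹ = s σ * G.ofGrp σ g' * (s σ)⁻¹ :=
      congrArg Subtype.val (congrArg Subtype.val h)
    exact hσ (mul_left_cancel (mul_right_cancel h'))
  · rintro ⟨⟨z, hz⟩, hzs⟩
    obtain ⟨g, hg⟩ : ∃ g : G.grp σ, s σ = z * s σ * G.ofGrp σ g :=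
      G.exists_of_mk_eq (mk_eq_of_devObj_eq (hx := IsPathElt.mul hz (hs σ)) (hy := hs σ) hzs)
    refine ⟨(g⁻¹ : G.grp σ), Subtype.ext (Subtype.ext ?_)⟩
    change s σ * G.ofGrp σ g⁻¹ * (s σ)⁻¹ = z
    rw [map_inv, mul_inv_eq_iff_eq_mul, mul_inv_eq_iff_eq_mul]
    exact hg

end Lifts

end Development

end ComplexOfGroups

/-! ### Connectedness of the development. -/

namespace ComplexOfGroups

section SimplyConnected

variable {Y : Scwol.{u, v}} (G : ComplexOfGroups.{u, v, w} Y) (σ₀ : Y.V)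

variable {G σ₀} in
/-- The edge over `a` with a given target. -/
def devEdgeTo {σ τ : Y.V} (a : Y.Edge σ τ) {x : UniversalGroup G} (hx : G.IsPathElt σ₀ τ x) :
    (G.development σ₀).Edge (G.devObj (hx.mul (G.isPathElt_ofEdge a))) (G.devObj hx) :=
  ⟨a, by
    change (QuotientGroup.mk (x * G.ofEdge a * (G.ofEdge a)⁻¹) : G.Cosets τ) = _
    rw [mul_inv_cancel_right]
    rfl⟩

theorem development_isConnected : (G.development σ₀).IsConnected := by
  -- A path element lifts from every starting coset: its edges lift to edges, and its local factors
  -- only change the representative.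
  have key {σ τ : Y.V} {z : UniversalGroup G} (hz : G.IsPathElt σ τ z) :
      ∀ {x : UniversalGroup G} (hx : G.IsPathElt σ₀ σ x),
        Nonempty ((G.development σ₀).Path (G.devObj hx) (G.devObj (hx.mul hz))) := by
    induction hz with
    | @nil σ g =>
      intro x hx
      rw [devObj_eq (hx.mul (.nil g)) hx (G.mk_mul_ofGrp x g)]
      exact ⟨.nil _⟩
    | @pos σ τ ρ g a z hz ih =>
      intro x hx
      have h : G.IsPathElt σ₀ τ (x * G.ofGrp τ g) := hx.mul (.nil g)
      obtain ⟨q⟩ := ih (h.mul (G.isPathElt_ofEdge a))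
      rw [devObj_eq hx h (G.mk_mul_ofGrp x g).symm]
      refine ⟨.pos (devEdgeTo a h) ?_⟩
      rwa [devObj_eq (hx.mul (.pos g a hz)) ((h.mul (G.isPathElt_ofEdge a)).mul hz)
        (by simp only [mul_assoc])]
    | @neg σ τ ρ g a z hz ih =>
      intro x hx
      have h : G.IsPathElt σ₀ σ (x * G.ofGrp σ g) := hx.mul (.nil g)
      obtain ⟨q⟩ := ih (h.mul (G.isPathElt_ofEdge_inv a))
      rw [devObj_eq hx h (G.mk_mul_ofGrp x g).symm]
      refine ⟨.neg (devEdge a h) ?_⟩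
      rwa [devObj_eq (hx.mul (.neg g a hz)) ((h.mul (G.isPathElt_ofEdge_inv a)).mul hz)
        (by simp only [mul_assoc])]
  refine ⟨⟨G.devObj (G.isPathElt_one σ₀)⟩, fun p q => ?_⟩
  obtain ⟨σ, C, x, hx, rfl⟩ := p
  obtain ⟨τ, D, y, hy, rfl⟩ := q
  -- Starting at `x`, lifting the path element `x⁻¹y` ends at `y`.
  have h := key (hx.inv.mul hy) hx
  rwa [devObj_eq (hx.mul (hx.inv.mul hy)) hy (by rw [mul_inv_cancel_left])] at h

end SimplyConnected

end ComplexOfGroups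

/-! ### Homotopy classes of edge paths. -/

namespace Scwol

variable (X : Scwol.{u, v})

/-- The setoid of homotopic edge paths. -/
def homotopySetoid (p q : X.V) : Setoid (X.Path p q) where
  r := X.Homotopic
  iseqv := ⟨.refl, .symm, .trans⟩

/-- Homotopy classes of edge paths. -/
abbrev PathClass (p q : X.V) : Type (max u v) := Quotient (X.homotopySetoid p q)

variable {X}

/-- Composition of `a⁺` with a homotopy class of edge paths. -/
def PathClass.pos {p q r : X.V} (a : X.Edge p q) : X.PathClass p r → X.PathClass q r :=
  Quotient.map (.pos a) fun _ _ h => .pos_congr a h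

/-- Composition of `a⁻` with a homotopy class of edge paths. -/
def PathClass.neg {p q r : X.V} (a : X.Edge p q) : X.PathClass q r → X.PathClass p r :=
  Quotient.map (.neg a) fun _ _ h => .neg_congr a h

theorem PathClass.pos_neg {p q r : X.V} (a : X.Edge p q) (c : X.PathClass q r) :
    (c.neg a).pos a = c := by
  induction c using Quotient.inductionOn with
  | h f => exact Quotient.sound (.pos_neg a f)

theorem PathClass.neg_pos {p q r : X.V} (a : X.Edge p q) (c : X.PathClass p r) :
    (c.pos a).neg a = c := by
  induction c using Quotient.inductionOn with
  | h f => exact Quotient.sound (.neg_pos a f)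

theorem PathClass.pos_pos {p q r s : X.V} (a : X.Edge q r) (b : X.Edge p q)
    (c : X.PathClass p s) : (c.pos b).pos a = c.pos (X.comp a b) := by
  induction c using Quotient.inductionOn with
  | h f => exact Quotient.sound (.pos_pos a b f)

end Scwol

/-! ### Monodromy on marked path classes and simple connectedness. -/

namespace ComplexOfGroups

variable {Y : Scwol.{u, v}} (G : ComplexOfGroups.{u, v, w} Y) (σ₀ : Y.V)
  (q : (G.development σ₀).V)

/-- Elements `x` of `FG(Y)` together with a homotopy class of edge paths in the development
from `x G_σ` to the object `q`. -/
structure MarkedClass (σ : Y.V) where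
  elt : UniversalGroup G
  coset : G.PathCosets σ₀ σ
  mk_elt : QuotientGroup.mk elt = coset.1
  cls : (G.development σ₀).PathClass ⟨σ, coset⟩ q

namespace MarkedClass

variable {G σ₀ q}

/-- Right multiplication by an element of the local group. -/
def mulRight {σ : Y.V} (m : MarkedClass G σ₀ q σ) (g : G.grp σ) : MarkedClass G σ₀ q σ :=
  ⟨m.elt * G.ofGrp σ g, m.coset, by rw [mk_mul_ofGrp, m.mk_elt], m.cls⟩

theorem ext_elt {σ : Y.V} {x y : UniversalGroup G} (h : x = y) {C : G.PathCosets σ₀ σ}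
    (hx : QuotientGroup.mk x = C.1) (hy : QuotientGroup.mk y = C.1)
    (c : (G.development σ₀).PathClass ⟨σ, C⟩ q) :
    (⟨x, C, hx, c⟩ : MarkedClass G σ₀ q σ) = ⟨y, C, hy, c⟩ := by
  subst h; rfl

theorem mulRight_mul {σ : Y.V} (m : MarkedClass G σ₀ q σ) (g g' : G.grp σ) :
    m.mulRight (g * g') = (m.mulRight g).mulRight g' :=
  ext_elt (by rw [mulRight, map_mul, mul_assoc]) _ _ _

theorem mulRight_one {σ : Y.V} (m : MarkedClass G σ₀ q σ) : m.mulRight 1 = m :=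
  ext_elt (by rw [map_one, mul_one]) _ m.mk_elt _

/-- Transport of the coset along an edge. -/
def shift {σ τ : Y.V} (a : Y.Edge σ τ) (C : G.PathCosets σ₀ σ) : G.PathCosets σ₀ τ :=
  ⟨G.cosetShift a C.1, by
    obtain ⟨x, hx, h⟩ := C.2
    exact ⟨_, hx.mul (G.isPathElt_ofEdge_inv a), by rw [← h]; rfl⟩⟩

/-- Traversal of an edge from its source to its target. -/
def push {σ τ : Y.V} (a : Y.Edge σ τ) (m : MarkedClass G σ₀ q σ) : MarkedClass G σ₀ q τ :=
  ⟨m.elt * (G.ofEdge a)⁻¹, shift a m.coset, by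
    rw [← cosetShift_mk, m.mk_elt]; rfl,
    .pos (X := G.development σ₀) (p := ⟨σ, m.coset⟩) (q := ⟨τ, shift a m.coset⟩) ⟨a, rfl⟩ m.cls⟩

theorem path_of_mk {σ : Y.V} {C : G.PathCosets σ₀ σ} {x : UniversalGroup G}
    (h : QuotientGroup.mk x = C.1) : G.IsPathElt σ₀ σ x := by
  obtain ⟨y, hy, h'⟩ := C.2
  obtain ⟨g, rfl⟩ := G.exists_of_mk_eq (h'.trans h.symm)
  exact hy.mul (.nil g)

/-- Traversal of an edge from its target to its source. -/
def pull {σ τ : Y.V} (a : Y.Edge σ τ) (m : MarkedClass G σ₀ q τ) : MarkedClass G σ₀ q σ :=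
  ⟨m.elt * G.ofEdge a,
    ⟨QuotientGroup.mk (m.elt * G.ofEdge a), _,
      (path_of_mk m.mk_elt).mul (G.isPathElt_ofEdge a), rfl⟩, rfl,
    .neg (X := G.development σ₀) (p := ⟨σ, _⟩) (q := ⟨τ, m.coset⟩) ⟨a, by
      change (QuotientGroup.mk (m.elt * G.ofEdge a * (G.ofEdge a)⁻¹) : G.Cosets τ) = _
      rw [mul_inv_cancel_right, m.mk_elt]⟩ m.cls⟩

theorem push_eq {σ τ : Y.V} (a : Y.Edge σ τ) {x : UniversalGroup G} {y : UniversalGroup G}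
    (hxy : x * (G.ofEdge a)⁻¹ = y) {C : G.PathCosets σ₀ σ} {D : G.PathCosets σ₀ τ}
    (hx : QuotientGroup.mk x = C.1) (hy : QuotientGroup.mk y = D.1)
    (h : G.cosetShift a C.1 = D.1) (c : (G.development σ₀).PathClass ⟨σ, C⟩ q) :
    push a ⟨x, C, hx, c⟩ =
      ⟨y, D, hy, .pos (X := G.development σ₀) (p := ⟨σ, C⟩) (q := ⟨τ, D⟩) ⟨a, h⟩ c⟩ := by
  subst hxy
  obtain rfl : shift a C = D := Subtype.ext h
  rfl

theorem pull_eq {σ τ : Y.V} (a : Y.Edge σ τ) {x : UniversalGroup G} {y : UniversalGroup G}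
    (hxy : x * G.ofEdge a = y) {C : G.PathCosets σ₀ τ} {D : G.PathCosets σ₀ σ}
    (hx : QuotientGroup.mk x = C.1) (hy : QuotientGroup.mk y = D.1)
    (h : G.cosetShift a D.1 = C.1) (c : (G.development σ₀).PathClass ⟨τ, C⟩ q) :
    pull a ⟨x, C, hx, c⟩ =
      ⟨y, D, hy, .neg (X := G.development σ₀) (p := ⟨σ, D⟩) (q := ⟨τ, C⟩) ⟨a, h⟩ c⟩ := by
  subst hxy
  obtain ⟨D, hD⟩ := D
  dsimp only at hy
  subst hy
  rfl

theorem push_pull {σ τ : Y.V} (a : Y.Edge σ τ) (m : MarkedClass G σ₀ q τ) :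
    (m.pull a).push a = m := by
  obtain ⟨x, C, hx, c⟩ := m
  refine (push_eq a (mul_inv_cancel_right x _) _ hx ?_ _).trans ?_
  · change (QuotientGroup.mk (x * G.ofEdge a * (G.ofEdge a)⁻¹) : G.Cosets τ) = _
    rw [mul_inv_cancel_right, hx]
  · exact congrArg (MarkedClass.mk x C hx) (Scwol.PathClass.pos_neg _ c)

theorem pull_push {σ τ : Y.V} (a : Y.Edge σ τ) (m : MarkedClass G σ₀ q σ) :
    (m.push a).pull a = m := by
  obtain ⟨x, C, hx, c⟩ := m
  refine (pull_eq a (inv_mul_cancel_right x _) _ hx rfl _).trans ?_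
  exact congrArg (MarkedClass.mk x C hx) (Scwol.PathClass.neg_pos _ c)

/-- The relation `a⁺b⁺ = g_{a,b}(ab)⁺`: the paths agree by the homotopy for composed edges, and the
twist is seen only by the marking. -/
theorem push_push {σ τ ρ : Y.V} (a : Y.Edge τ ρ) (b : Y.Edge σ τ) (m : MarkedClass G σ₀ q σ) :
    (m.push b).push a = (m.push (Y.comp a b)).mulRight (G.tw a b)⁻¹ := by
  obtain ⟨x, C, hx, c⟩ := m
  have h := ((push (Y.comp a b) ⟨x, C, hx, c⟩).mulRight (G.tw a b)⁻¹).mk_elt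
  refine (push_eq a ?_ _ h ?_ _).trans
    (congrArg (MarkedClass.mk _ _ h) (Scwol.PathClass.pos_pos _ _ c))
  · change x * _ * _ = x * _ * _
    rw [mul_assoc, ← mul_inv_rev, ofEdge_mul, map_inv, mul_inv_rev, mul_assoc]
  · exact (G.cosetShift_comp a b C.1).symm

/-- The relation `a⁺ g a⁻ = ψ_a(g)`; only the marking is affected. -/
theorem push_mulRight {σ τ : Y.V} (a : Y.Edge σ τ) (g : G.grp σ) (m : MarkedClass G σ₀ q σ) :
    (m.mulRight g).push a = (m.push a).mulRight (G.ψ a g) := by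
  obtain ⟨x, C, hx, c⟩ := m
  refine push_eq a ?_ _ _ _ _
  change x * _ * _ = x * _ * _
  rw [← ofEdge_conj]
  group

/-- Right multiplication by inverses, as an action of the local group. -/
def localPerm (σ : Y.V) : G.grp σ →* Equiv.Perm (MarkedClass G σ₀ q σ) :=
  MonoidHom.toHomPerm
    { toFun := fun g m => m.mulRight g⁻¹
      map_one' := funext fun m => by rw [inv_one]; exact m.mulRight_one
      map_mul' := fun g h => funext fun m => by
        rw [mul_inv_rev]; exact m.mulRight_mul _ _ }

/-- Traversal of an edge as a bijection. -/
def edgeEquiv {σ τ : Y.V} (a : Y.Edge σ τ) : MarkedClass G σ₀ q σ ≃ MarkedClass G σ₀ q τ :=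
  ⟨push a, pull a, pull_push a, push_pull a⟩

/-- The moves go between fibres over different objects, while the group `FG(Y)` has to act on a
single set. Arbitrary bijections between the fibres suffice to transport the moves to one of them.
-/
theorem nonempty_equiv {σ τ : Y.V} (p : Y.Path σ τ) :
    Nonempty (MarkedClass G σ₀ q τ ≃ MarkedClass G σ₀ q σ) := by
  induction p with
  | nil => exact ⟨.refl _⟩
  | pos a _ ih => exact ih.map fun e => e.trans (edgeEquiv a)
  | neg a _ ih => exact ih.map fun e => e.trans (edgeEquiv a).symm

section Perm

variable (T : ∀ σ : Y.V, MarkedClass G σ₀ q σ ≃ MarkedClass G σ₀ q σ₀)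

/-- Traversal of an edge, all the fibres being identified with one of them. -/
def edgePerm {σ τ : Y.V} (a : Y.Edge σ τ) : Equiv.Perm (MarkedClass G σ₀ q σ₀) :=
  ((T σ).symm.trans (edgeEquiv a)).trans (T τ)

/-- The action of a local group, all the fibres being identified with one of them. -/
def grpPerm (σ : Y.V) : G.grp σ →* Equiv.Perm (MarkedClass G σ₀ q σ₀) :=
  (T σ).permCongrHom.toMonoidHom.comp (localPerm σ)

theorem edgePerm_apply {σ τ : Y.V} (a : Y.Edge σ τ) (m : MarkedClass G σ₀ q σ) :
    edgePerm T a (T σ m) = T τ (m.push a) := by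
  change T τ (((T σ).symm (T σ m)).push a) = _
  rw [Equiv.symm_apply_apply]

theorem grpPerm_apply {σ : Y.V} (g : G.grp σ) (m : MarkedClass G σ₀ q σ) :
    grpPerm T σ g (T σ m) = T σ (m.mulRight g⁻¹) := by
  change T σ (((T σ).symm (T σ m)).mulRight g⁻¹) = _
  rw [Equiv.symm_apply_apply]

theorem edgePerm_mul {σ τ ρ : Y.V} (a : Y.Edge τ ρ) (b : Y.Edge σ τ) :
    edgePerm T a * edgePerm T b = grpPerm T ρ (G.tw a b) * edgePerm T (Y.comp a b) := by
  ext1 m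
  obtain ⟨m, rfl⟩ := (T σ).surjective m
  simp only [Equiv.Perm.mul_apply, edgePerm_apply, grpPerm_apply, push_push]

theorem edgePerm_mul_grpPerm {σ τ : Y.V} (a : Y.Edge σ τ) (g : G.grp σ) :
    edgePerm T a * grpPerm T σ g = grpPerm T τ (G.ψ a g) * edgePerm T a := by
  ext1 m
  obtain ⟨m, rfl⟩ := (T σ).surjective m
  simp only [Equiv.Perm.mul_apply, edgePerm_apply, grpPerm_apply, push_mulRight, map_inv]

/-- The action of `FG(Y)` that extends the actions of the local groups and the traversals of
edges. -/
def perm : UniversalGroup G →* Equiv.Perm (MarkedClass G σ₀ q σ₀) :=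
  G.universalLift (grpPerm T) (edgePerm T) (edgePerm_mul T) (edgePerm_mul_grpPerm T)

theorem perm_ofGrp {σ : Y.V} (g : G.grp σ) (m : MarkedClass G σ₀ q σ) :
    perm T (G.ofGrp σ g) (T σ m) = T σ (m.mulRight g⁻¹) := by
  rw [perm, universalLift_ofGrp, grpPerm_apply]

theorem perm_ofEdge {σ τ : Y.V} (a : Y.Edge σ τ) (m : MarkedClass G σ₀ q σ) :
    perm T (G.ofEdge a) (T σ m) = T τ (m.push a) := by
  rw [perm, universalLift_ofEdge, edgePerm_apply]

theorem perm_ofEdge_inv {σ τ : Y.V} (a : Y.Edge σ τ) (m : MarkedClass G σ₀ q τ) :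
    perm T (G.ofEdge a)⁻¹ (T τ m) = T σ (m.pull a) := by
  rw [map_inv, Equiv.Perm.inv_eq_iff_eq, perm_ofEdge, push_pull]

variable {y : UniversalGroup G} (hy : QuotientGroup.mk y = q.2.1)

/-- The constant path at `q`. -/
def base : MarkedClass G σ₀ q q.1 := ⟨y, q.2, hy, Quotient.mk _ (.nil q)⟩

/-- The path is rebuilt from the constant path at `q` edge by edge, each letter of `x⁻¹y` acting by
the matching move. The acting element depends on the two representatives only, not on `f`. -/
theorem perm_path {p q : (G.development σ₀).V} (f : (G.development σ₀).Path p q)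
    (T : ∀ σ : Y.V, MarkedClass G σ₀ q σ ≃ MarkedClass G σ₀ q σ₀)
    {y : UniversalGroup G} (hy : QuotientGroup.mk y = q.2.1) :
    ∀ (x : UniversalGroup G) (hx : QuotientGroup.mk x = p.2.1),
      perm T (x⁻¹ * y) (T q.1 (base hy)) = T p.1 ⟨x, p.2, hx, Quotient.mk _ f⟩ := by
  induction f with
  | nil q =>
    intro x hx
    obtain ⟨g, rfl⟩ := G.exists_of_mk_eq (hy.trans hx.symm)
    rw [mul_inv_rev, inv_mul_cancel_right, ← map_inv, perm_ofGrp]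
    exact congrArg _ (ext_elt (by rw [inv_inv]; rfl) _ _ _)
  | @pos p p' q a f ih =>
    intro x hx
    -- The element `x a⁺` need not represent `p`, as several edges over `a` may end at `p'`. So a
    -- representative `z` of `p` is chosen, and `x` is corrected by a local element `g`.
    obtain ⟨z, hz, hz'⟩ := p.2.2
    have hzx : QuotientGroup.mk (z * (G.ofEdge a.1)⁻¹) = p'.2.1 :=
      (congrArg (G.cosetShift a.1) hz').trans a.2
    obtain ⟨g, rfl⟩ := G.exists_of_mk_eq (hzx.trans hx.symm)
    have h : (z * (G.ofEdge a.1)⁻¹ * G.ofGrp p'.1 g)⁻¹ * y =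
        G.ofGrp p'.1 g⁻¹ * (G.ofEdge a.1 * (z⁻¹ * y)) := by
      rw [map_inv]; group
    rw [h, map_mul, map_mul, Equiv.Perm.mul_apply, Equiv.Perm.mul_apply, ih T hy z hz',
      perm_ofEdge, perm_ofGrp, push_eq a.1 rfl hz' hzx a.2]
    exact congrArg _ (ext_elt (by rw [inv_inv]) _ _ _)
  | @neg p p' q a f ih =>
    intro x hx
    have hxa : QuotientGroup.mk (x * (G.ofEdge a.1)⁻¹) = p'.2.1 :=
      (congrArg (G.cosetShift a.1) hx).trans a.2
    have h : x⁻¹ * y = (G.ofEdge a.1)⁻¹ * ((x * (G.ofEdge a.1)⁻¹)⁻¹ * y) := by group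
    rw [h, map_mul, Equiv.Perm.mul_apply, ih T hy _ hxa, perm_ofEdge_inv,
      pull_eq a.1 (inv_mul_cancel_right _ _) hxa hx a.2]
    rfl

end Perm

end MarkedClass

theorem development_homotopic (hY : Y.IsConnected) {p q : (G.development σ₀).V}
    (f f' : (G.development σ₀).Path p q) : (G.development σ₀).Homotopic f f' := by
  have T (σ : Y.V) : MarkedClass G σ₀ q σ ≃ MarkedClass G σ₀ q σ₀ :=
    (MarkedClass.nonempty_equiv (hY.2 σ₀ σ).some).some
  obtain ⟨x, -, hx⟩ := p.2.2
  obtain ⟨y, -, hy⟩ := q.2.2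
  -- Both marked classes are the image of the same constant path under the same element `x⁻¹y`.
  have h := (MarkedClass.perm_path f T hy x hx).symm.trans (MarkedClass.perm_path f' T hy x hx)
  have h' := (T p.1).injective h
  simp only [MarkedClass.mk.injEq, heq_eq_eq, true_and] at h'
  exact Quotient.exact h'

theorem development_isSimplyConnected (hY : Y.IsConnected) :
    (G.development σ₀).IsSimplyConnected :=
  ⟨G.development_isConnected σ₀, fun _ p => G.development_homotopic σ₀ hY p _⟩

variable {G} in
theorem isDevelopable_of_injective (hY : Y.IsConnected)
    (hG : ∀ σ, Function.Injective (G.ofGrp σ)) : G.IsDevelopable := by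
  obtain ⟨σ₀⟩ := hY.1
  choose s hs using fun σ => G.exists_isPathElt (hY.2 σ₀ σ).some
  exact ⟨G.development σ₀, G.piOne σ₀, inferInstance, G.devAction σ₀, G.devQuotientMap σ₀ hY,
    G.devLifts σ₀ hY hs, G.development_isSimplyConnected σ₀ hY, G.devHom σ₀ hY hs,
    fun σ => G.devHom_bijective σ₀ hY hs σ (hG σ)⟩

end ComplexOfGroups

theorem corollary1p2 (Y : Scwol.{u, v}) (hY : Y.IsConnected) (G : ComplexOfGroups.{u, v, w} Y) :
    G.IsDevelopable ↔ ∀ γ : Y.V, (G.sigma γ).IsPiOneInjective := by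
  simp only [ComplexOfGroups.sigma_isPiOneInjective_iff]
  exact ⟨fun h => h.ofGrp_injective, ComplexOfGroups.isDevelopable_of_injective hY⟩
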